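/- Let $\mathbb{T}^\infty$ be the countable product of the unit circle $\mathbb{T}\subset\mathbb{C}$ with the product $m$ of the normalized Lebesgue measures. For $f\in L_\infty(\mathbb{T}^\infty)$ and $\alpha\in\mathbb{Z}^{(\mathbb{N})}$ (finitely supported integer sequences) put $\hat f(\alpha)=\int_{\mathbb{T}^\infty} f(w)\,w^{-\alpha}\,dm(w)$. Let $$H_\infty(\mathbb{T}^\infty)=\{f\in L_\infty(\mathbb{T}^\infty):\ \hat f(\alpha)=0\ \text{ for all } \alpha\in\mathbb{Z}^{(\mathbb{N})}\setminus\mathbb{N}_0^{(\mathbb{N})}\}$$ with the $L_\infty$-norm, and for $k\in\mathbb{N}_0$ let $H_\infty^k(\mathbb{T}^\infty)=\{f\in H_\infty(\mathbb{T}^\infty):\ \hat f(\alpha)\ne 0\Rightarrow|\alpha|=k\}$. Let $\mathbb{D}_0^\infty$ be the open unit ball of $c_0$ and $H_\infty(\mathbb{D}_0^\infty)$ the Banach space of bounded holomorphic (complex Fréchet differentiable) functions on $\mathbb{D}_0^\infty$ with the supremum norm. The monomial coefficients of $g\in H_\infty(\mathbb{D}_0^\infty)$ are the unique family $(c_\alpha(g))_{\alpha\in\mathbb{N}_0^{(\mathbb{N})}}$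 with $g(z)=\sum_\alpha c_\alpha(g)z^\alpha$ for all finitely supported $z\in\mathbb{D}_0^\infty$. Let $\mathcal{P}(^k c_0)$ be the space of bounded $k$-homogeneous polynomials on $c_0$, that is, the restrictions to the diagonal of bounded $k$-linear forms on $c_0$, regarded as a subspace of $H_\infty(\mathbb{D}_0^\infty)$ by restriction to $\mathbb{D}_0^\infty$. For $P\in\mathcal{P}(^k c_0)$ with associated symmetric $k$-linear form $A$, the Aron–Berner extension $AB(P):\ell_\infty\to\mathbb{C}$ is $AB(P)(z)=\tilde A(z,\dots,z)$, where $\tilde A$ is the Arens extension of $A$: the unique bounded $k$-linear extension of $A$ to $\ell_\infty=c_0^{**}$ such that $y\mapsto\tilde A(x_1,\dots,x_{j-1},y,z_{j+1},\dots,z_k)$ is weak$^*$-continuous for all $j$, all $x_i\in c_0$ and all $z_i\in\ell_\infty$. **Proposition.** There exists a unique surjective isometry $\phi:H_\infty(\mathbb{T}^\infty)\to H_\infty(\mathbb{D}_0^\infty)$ such that $c_\alpha(\phi(f))=\hat f(\alpha)$ for every $f\in H_\infty(\mathbb{T}^\infty)$ and every $\alpha\in\mathbb{N}_0^{(\mathbb{N})}$;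 it is linear, and it is the only mapping, isometric or not, with these coefficients. Moreover, for every $k\in\mathbb{N}_0$, the formula $\psi(P)(w)=AB(P)(w)$ for almost every $w\in\mathbb{T}^\infty$ defines a linear bijection $\psi:\mathcal{P}(^k c_0)\to H_\infty^k(\mathbb{T}^\infty)$, and the restriction of $\phi$ to $H_\infty^k(\mathbb{T}^\infty)$ and $\psi$ are inverse to each other: $\phi(\psi(P))=P$ on $\mathbb{D}_0^\infty$ for all $P\in\mathcal{P}(^k c_0)$, and $\phi(f)=\psi^{-1}(f)$ on $\mathbb{D}_0^\infty$ for all $f\in H_\infty^k(\mathbb{T}^\infty)$. -/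

import Mathlib

open MeasureTheory Set Filter
open scoped ENNReal Topology BoundedContinuousFunction ZeroAtInfty

namespace PolyHardy

noncomputable section

/-! ### The infinite polytorus, Fourier coefficients and Hardy spaces -/

instance instMeasurableSpaceCircle : MeasurableSpace Circle := borel Circle

instance instBorelSpaceCircle : BorelSpace Circle := ⟨rfl⟩

/-- The normalized Lebesgue measure on the unit circle `𝕋`: the image of the normalized measure
on `ℝ / ℤ` under `θ ↦ e^{2πiθ}`. -/
def circleMeasure : Measure Circle :=
  (AddCircle.haarAddCircle (T := (1 : ℝ))).map AddCircle.toCircle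

instance instIsProbabilityMeasureCircleMeasure : IsProbabilityMeasure circleMeasure :=
  Measure.isProbabilityMeasure_map AddCircle.continuous_toCircle.measurable.aemeasurable

/-- The infinite polytorus `𝕋^∞`. -/
abbrev Torus : Type := ℕ → Circle

/-- The product `m` of the normalized Lebesgue measures on `𝕋^∞`. -/
def torusMeasure : Measure Torus := Measure.infinitePi fun _ => circleMeasure

instance instIsProbabilityMeasureTorusMeasure : IsProbabilityMeasure torusMeasure := by
  unfold torusMeasure; infer_instance

/-- The monomial `w ^ α` on `𝕋^∞` for a finitely supported multi-index of integers. -/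
def torusMonomial (α : ℕ →₀ ℤ) (w : Torus) : ℂ := α.prod fun i a => ((w i : Circle) : ℂ) ^ a

theorem measurable_torusMonomial (α : ℕ →₀ ℤ) : Measurable (torusMonomial α) := by
  unfold torusMonomial Finsupp.prod
  refine Finset.measurable_prod _ fun i _ => ?_
  have h : Continuous fun c : Circle => (c : ℂ) ^ (α i) :=
    Continuous.zpow₀ (f := fun c : Circle => (c : ℂ)) continuous_subtype_val (α i)
      fun c => Or.inl (Circle.coe_ne_zero c)
  exact h.measurable.comp (measurable_pi_apply i)

theorem norm_torusMonomial (α : ℕ →₀ ℤ) (w : Torus) : ‖torusMonomial α w‖ = 1 := by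
  simp [torusMonomial, Finsupp.prod, norm_prod, norm_zpow, Circle.norm_coe]

/-- The space `L_∞(𝕋^∞)`. -/
abbrev LInfTorus : Type := Lp ℂ ∞ torusMeasure

/-- The Fourier coefficient `f̂(α) = ∫ f(w) w^{-α} dm(w)`. -/
def fourierCoeff (f : LInfTorus) (α : ℕ →₀ ℤ) : ℂ :=
  ∫ w, f w * torusMonomial (-α) w ∂torusMeasure

theorem integrable_mul_torusMonomial (f : LInfTorus) (α : ℕ →₀ ℤ) :
    Integrable (fun w => f w * torusMonomial α w) torusMeasure :=
  ((Lp.memLp f).integrable le_top).mul_bdd (c := 1)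
    (measurable_torusMonomial α).aestronglyMeasurable
    (Eventually.of_forall fun w => (norm_torusMonomial α w).le)

theorem fourierCoeff_zero (α : ℕ →₀ ℤ) : fourierCoeff 0 α = 0 := by
  rw [fourierCoeff, integral_congr_ae (g := fun _ => (0 : ℂ))]
  · simp
  · filter_upwards [Lp.coeFn_zero ℂ ∞ torusMeasure] with w hw
    rw [hw, Pi.zero_apply, zero_mul]

theorem fourierCoeff_add (f g : LInfTorus) (α : ℕ →₀ ℤ) :
    fourierCoeff (f + g) α = fourierCoeff f α + fourierCoeff g α := by
  rw [fourierCoeff, fourierCoeff, fourierCoeff,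
    ← integral_add (integrable_mul_torusMonomial f _) (integrable_mul_torusMonomial g _)]
  refine integral_congr_ae ?_
  filter_upwards [Lp.coeFn_add f g] with w hw
  rw [hw, Pi.add_apply, add_mul]

theorem fourierCoeff_smul (c : ℂ) (f : LInfTorus) (α : ℕ →₀ ℤ) :
    fourierCoeff (c • f) α = c * fourierCoeff f α := by
  rw [fourierCoeff, fourierCoeff, ← integral_const_mul]
  refine integral_congr_ae ?_
  filter_upwards [Lp.coeFn_smul c f] with w hw
  rw [hw, Pi.smul_apply, smul_eq_mul, mul_assoc]

/-- The Hardy space `H_∞(𝕋^∞)`: all `f ∈ L_∞(𝕋^∞)` with `f̂(α) = 0` for every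
`α ∈ ℤ^(ℕ) \ ℕ₀^(ℕ)`; it carries the norm of `L_∞(𝕋^∞)`. -/
def HInfTorus : Submodule ℂ LInfTorus where
  carrier := {f | ∀ α : ℕ →₀ ℤ, (¬ ∀ i, 0 ≤ α i) → fourierCoeff f α = 0}
  zero_mem' := fun α _ => fourierCoeff_zero α
  add_mem' := fun {f g} hf hg α hα => by rw [fourierCoeff_add, hf α hα, hg α hα, add_zero]
  smul_mem' := fun c f hf α hα => by rw [fourierCoeff_smul, hf α hα, mul_zero]

/-- The inclusion `ℕ₀^(ℕ) ⊆ ℤ^(ℕ)` of multi-indices. -/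
def toIntIndex (α : ℕ →₀ ℕ) : ℕ →₀ ℤ := α.mapRange (fun a : ℕ => (a : ℤ)) rfl

/-- The Fourier coefficients `f̂(α)`, `α ∈ ℕ₀^(ℕ)`, of `f ∈ H_∞(𝕋^∞)`. -/
def hardyCoeff (f : HInfTorus) (α : ℕ →₀ ℕ) : ℂ := fourierCoeff (f : LInfTorus) (toIntIndex α)

/-- The `m`-homogeneous part `H_∞^m(𝕋^∞)`: all `f ∈ H_∞(𝕋^∞)` such that `f̂(α) ≠ 0` only if
`|α| = m`. -/
def HInfTorusHom (m : ℕ) : Submodule ℂ HInfTorus where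
  carrier := {f | ∀ α : ℕ →₀ ℕ, hardyCoeff f α ≠ 0 → α.degree = m}
  zero_mem' := fun α hα => (hα (fourierCoeff_zero _)).elim
  add_mem' := fun {f g} hf hg α hα => by
    by_contra hm
    have h1 : hardyCoeff f α = 0 := by_contra fun h => hm (hf α h)
    have h2 : hardyCoeff g α = 0 := by_contra fun h => hm (hg α h)
    refine hα ?_
    have h3 : hardyCoeff (f + g) α = hardyCoeff f α + hardyCoeff g α := fourierCoeff_add _ _ _
    rw [h3, h1, h2, add_zero]
  smul_mem' := fun c f hf α hα => by
    refine hf α fun h => hα ?_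
    have h3 : hardyCoeff (c • f) α = c * hardyCoeff f α := fourierCoeff_smul _ _ _
    rw [h3, h, mul_zero]

/-! ### Bounded holomorphic functions on the open unit ball of `c₀` -/

/-- The Banach space `c₀` of complex null sequences with the supremum norm. -/
abbrev CZero : Type := C₀(ℕ, ℂ)

/-- `𝔻₀^∞`, the open unit ball of `c₀`. -/
abbrev CZeroBall : Type := Metric.ball (0 : CZero) 1

/-- A function on `𝔻₀^∞` is holomorphic if it is complex Fréchet differentiable at each point. -/
def IsHolomorphic (g : CZeroBall → ℂ) : Prop :=
  ∃ G : CZero → ℂ, DifferentiableOn ℂ G (Metric.ball 0 1) ∧ ∀ x : CZeroBall, G x = g x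

/-- The Banach space `H_∞(𝔻₀^∞)` of all bounded holomorphic functions on `𝔻₀^∞` (they are
continuous) with the supremum norm. -/
def HInfBall : Submodule ℂ (CZeroBall →ᵇ ℂ) where
  carrier := {g | IsHolomorphic g}
  zero_mem' := ⟨0, differentiableOn_const (0 : ℂ), fun _ => rfl⟩
  add_mem' := fun {g h} hg hh => by
    obtain ⟨G, hG, hGg⟩ := hg
    obtain ⟨H, hH, hHh⟩ := hh
    exact ⟨G + H, hG.add hH, fun x => by simp [hGg, hHh]⟩
  smul_mem' := fun c g hg => by
    obtain ⟨G, hG, hGg⟩ := hg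
    exact ⟨c • G, hG.const_smul c, fun x => by simp [hGg]⟩

/-- The family `c` is the family `(c_α(g))` of monomial coefficients of `g`: for all `k` and all
`z ∈ 𝔻^k`, identified with `𝔻^k × {0}`, the function `g` is given at `z` by the monomial series
expansion `g(z) = ∑_α c_α z^α`. -/
def IsMonomialCoeff (g : HInfBall) (c : (ℕ →₀ ℕ) → ℂ) : Prop :=
  ∀ (k : ℕ) (z : CZeroBall), (∀ i, k ≤ i → (z : CZero) i = 0) →
    HasSum (fun α : ℕ →₀ ℕ => c α * α.prod fun i a => (z : CZero) i ^ a)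
      ((g : CZeroBall →ᵇ ℂ) z)

/-! ### Homogeneous polynomials on `c₀` -/

/-- The bounded `m`-homogeneous polynomials `𝒫(^m c₀)`: the restrictions of bounded `m`-linear
forms to the diagonal. -/
def HomPoly (m : ℕ) : Submodule ℂ (CZero → ℂ) where
  carrier := {P | ∃ A : ContinuousMultilinearMap ℂ (fun _ : Fin m => CZero) ℂ,
    ∀ x, P x = A fun _ => x}
  zero_mem' := ⟨0, fun _ => rfl⟩
  add_mem' := fun {P Q} hP hQ => by
    obtain ⟨A, hA⟩ := hP
    obtain ⟨B, hB⟩ := hQ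
    exact ⟨A + B, fun x => by simp [hA, hB]⟩
  smul_mem' := fun c P hP => by
    obtain ⟨A, hA⟩ := hP
    exact ⟨c • A, fun x => by simp [hA]⟩

theorem HomPoly.differentiable {m : ℕ} (P : HomPoly m) :
    Differentiable ℂ (P : CZero → ℂ) := by
  obtain ⟨P, A, hA⟩ := P
  have h : P = fun x => A fun _ => x := funext hA
  subst h
  have h1 : Differentiable ℂ fun x : CZero => (fun _ : Fin m => x) :=
    differentiable_pi.2 fun _ => differentiable_id
  exact fun x => (A.hasFDerivAt _).differentiableAt.comp x (h1 x)

theorem HomPoly.exists_bound {m : ℕ} (P : HomPoly m) :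
    ∃ C : ℝ, ∀ x : CZeroBall, ‖(P : CZero → ℂ) x‖ ≤ C := by
  obtain ⟨P, A, hA⟩ := P
  refine ⟨‖A‖, fun x => ?_⟩
  change ‖P x‖ ≤ _
  rw [hA]
  refine (A.le_opNorm _).trans ?_
  have hx : ‖(x : CZero)‖ ≤ 1 := (mem_ball_zero_iff.1 x.2).le
  refine mul_le_of_le_one_right (norm_nonneg _) ?_
  simpa using pow_le_one₀ (norm_nonneg _) hx

/-- The restriction of `P ∈ 𝒫(^m c₀)` to `𝔻₀^∞`, an element of `H_∞(𝔻₀^∞)`. -/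
def HomPoly.toHInfBall {m : ℕ} (P : HomPoly m) : HInfBall :=
  ⟨BoundedContinuousFunction.ofNormedAddCommGroup (fun x : CZeroBall => (P : CZero → ℂ) x)
      ((HomPoly.differentiable P).continuous.comp continuous_subtype_val) (HomPoly.exists_bound P).choose
      (HomPoly.exists_bound P).choose_spec,
    ⟨P, (HomPoly.differentiable P).differentiableOn, fun _ => rfl⟩⟩

/-! ### The Aron–Berner extension from `c₀` to its bidual `ℓ_∞` -/

/-- The Banach space `ℓ_∞` of bounded complex sequences, the bidual of `c₀`. -/
abbrev EllInf : Type := lp (fun _ : ℕ => ℂ) ∞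

/-- The Banach space `ℓ₁` of summable complex sequences, the dual of `c₀`. -/
abbrev EllOne : Type := lp (fun _ : ℕ => ℂ) 1

/-- The canonical inclusion `c₀ ⊆ ℓ_∞`. -/
def CZero.toEllInf (x : CZero) : EllInf :=
  ⟨fun n => x n, memℓp_infty ⟨‖x‖, by
    rintro _ ⟨n, rfl⟩
    exact x.toBCF.norm_coe_le_norm n⟩⟩

/-- The inclusion `𝕋^∞ ⊆ ℓ_∞`. -/
def Torus.toEllInf (w : Torus) : EllInf :=
  ⟨fun n => (w n : ℂ), memℓp_infty ⟨1, by
    rintro _ ⟨n, rfl⟩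
    exact (Circle.norm_coe (w n)).le⟩⟩

/-- The weak* topology `σ(ℓ_∞, ℓ₁)` on `ℓ_∞`, i.e. the topology of pointwise convergence on `ℓ₁`
under the pairing `⟨z, a⟩ = ∑ z_n a_n`. -/
@[reducible] def weakStarTopology : TopologicalSpace EllInf :=
  TopologicalSpace.induced (fun (z : EllInf) (a : EllOne) => ∑' n, z n * a n) inferInstance

/-- `B` is the Arens extension of the bounded `m`-linear form `A` on `c₀` to `ℓ_∞`: it extends `A`,
and for all `j`, all `x_1, …, x_{j-1} ∈ c₀` and all `z_{j+1}, …, z_m ∈ ℓ_∞` the mapping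
`y ↦ B(x_1, …, x_{j-1}, y, z_{j+1}, …, z_m)` is weak*-continuous on `ℓ_∞`. -/
structure IsArensExtension {m : ℕ} (A : ContinuousMultilinearMap ℂ (fun _ : Fin m => CZero) ℂ)
    (B : ContinuousMultilinearMap ℂ (fun _ : Fin m => EllInf) ℂ) : Prop where
  extends_form : ∀ x : Fin m → CZero, B (fun i => CZero.toEllInf (x i)) = A x
  weakStar_continuous : ∀ (j : Fin m) (x : Fin m → CZero) (z : Fin m → EllInf),
    @Continuous EllInf ℂ weakStarTopology inferInstance fun y : EllInf =>
      B fun i => if i < j then CZero.toEllInf (x i) else if i = j then y else z i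

/-- `Q : ℓ_∞ → ℂ` is the Aron–Berner extension `AB(P)` of `P ∈ 𝒫(^m c₀)`: if `A` is the symmetric
`m`-linear form associated with `P` and `B` is its Arens extension, then
`Q(z) = B(z, …, z)`. -/
def IsAronBernerExtension {m : ℕ} (P : HomPoly m) (Q : EllInf → ℂ) : Prop :=
  ∃ (A : ContinuousMultilinearMap ℂ (fun _ : Fin m => CZero) ℂ)
    (B : ContinuousMultilinearMap ℂ (fun _ : Fin m => EllInf) ℂ),
    (∀ (σ : Equiv.Perm (Fin m)) (x : Fin m → CZero), A (fun i => x (σ i)) = A x) ∧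
    (∀ x : CZero, (P : CZero → ℂ) x = A fun _ => x) ∧
    IsArensExtension A B ∧
    ∀ z : EllInf, Q z = B fun _ => z

end

end PolyHardy

/-!
For `f ∈ H_∞(𝕋^∞)` and finitely supported `z` in the ball, the integral of `f` against the Poisson
kernel at `z`, the normalized square of the Szegő kernel, is `∑ f̂(α) z^α`; so this sum is bounded
by `‖f‖`, and by Montel's theorem the truncations `x ↦ ∑ f̂(α) (x_0, …, x_{n-1}, 0, …)^α` have a
holomorphic limit on the ball. Conversely, for bounded holomorphic `g` the functions
`w ↦ g(r w_0, …, r w_{n-1}, 0, …)` on `𝕋^∞` are bounded by `‖g‖`, and a weak limit as `n → ∞` and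
`r → 1` is an `f ∈ H_∞(𝕋^∞)` with `‖f‖ ≤ ‖g‖` and `f̂(α) = c_α(g)`. The two norm bounds give the
isometry.

If `P` is a homogeneous polynomial, expanding the Arens extension of its symmetric form one variable
at a time, under the integral by bounded convergence, shows that the Fourier coefficients of `AB(P)`
are the monomial coefficients of `P`. If `g` has monomial coefficients of degree `m` only, then its
truncations are polynomials, polarization bounds their symmetric forms uniformly, and a limit of
these forms represents `g` as an `m`-homogeneous polynomial.
-/

namespace PolyHardy

noncomputable section

section Limits

variable {E F : Type*} [NormedAddCommGroup E] [NormedSpace ℂ E] [NormedAddCommGroup F]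
  [NormedSpace ℂ F]

theorem exists_tendsto_ultrafilter_of_norm_le {X ι : Type*} [SeminormedAddCommGroup X]
    [ProperSpace X] (u : Ultrafilter ι) {f : ι → X} {M : ℝ} (hM : ∀ i, ‖f i‖ ≤ M) :
    ∃ a, Tendsto f u (𝓝 a) := by
  have hmem : ∀ᶠ x in u.map f, x ∈ Metric.closedBall (0 : X) M :=
    Eventually.of_forall (p := fun i => f i ∈ Metric.closedBall (0 : X) M) fun i =>
      mem_closedBall_zero_iff.2 (hM i)
  obtain ⟨a, -, ha⟩ :=
    (isCompact_closedBall (0 : X) M).ultrafilter_le_nhds (u.map f) (le_principal_iff.2 hmem)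
  exact ⟨a, ha⟩

theorem norm_fderiv_le_of_norm_le_ball {f : E → F} {x : E} {r M : ℝ} (hr : 0 < r)
    (hf : DifferentiableOn ℂ f (Metric.ball x r)) (hM : ∀ y ∈ Metric.ball x r, ‖f y‖ ≤ M) :
    ‖fderiv ℂ f x‖ ≤ 2 * M / r := by
  refine Complex.norm_fderiv_le_div_of_mapsTo_ball hf (fun y hy => ?_) hr
  rw [mem_closedBall_iff_norm]
  linarith [norm_sub_le (f y) (f x), hM y hy, hM x (Metric.mem_ball_self hr)]

theorem norm_sub_sub_fderiv_le_of_norm_le_ball {f : E → F} {x : E} {r M : ℝ} (hr : 0 < r)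
    (hf : DifferentiableOn ℂ f (Metric.ball x r)) (hM : ∀ y ∈ Metric.ball x r, ‖f y‖ ≤ M)
    {w : E} (hw : w ∈ Metric.ball x r) :
    ‖f w - f x - fderiv ℂ f x (w - x)‖ ≤ 4 * M * (‖w - x‖ / r) ^ 2 := by
  have hx : x ∈ Metric.ball x r := Metric.mem_ball_self hr
  have hM0 : 0 ≤ M := (norm_nonneg _).trans (hM x hx)
  -- The Schwarz lemma to second order applies to `f` minus its linear part.
  set h : E → F := fun w => f w - fderiv ℂ f x (w - x) with hh
  have hsub (w : E) : h w - h x = f w - f x - fderiv ℂ f x (w - x) := by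
    simp only [hh, sub_self, map_zero, sub_zero]; abel
  have hd : DifferentiableOn ℂ h (Metric.ball x r) := hf.sub (by fun_prop)
  have hmaps : MapsTo h (Metric.ball x r) (Metric.closedBall (h x) (4 * M)) := fun y hy => by
    have hlin : ‖fderiv ℂ f x (y - x)‖ ≤ 2 * M :=
      calc ‖fderiv ℂ f x (y - x)‖ ≤ 2 * M / r * ‖y - x‖ :=
            ContinuousLinearMap.le_of_opNorm_le _ (norm_fderiv_le_of_norm_le_ball hr hf hM) _
        _ ≤ 2 * M / r * r := by gcongr; exact (mem_ball_iff_norm.1 hy).le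
        _ = 2 * M := by field_simp
    rw [mem_closedBall_iff_norm, hsub]
    linarith [norm_sub_le (f y - f x) (fderiv ℂ f x (y - x)), norm_sub_le (f y) (f x), hM y hy,
      hM x hx]
  have hlittle : (h · - h x) =o[𝓝 x] fun w => ‖w - x‖ ^ 1 := by
    simp only [pow_one, hsub]
    exact (hasFDerivAt_iff_isLittleO.1
      (hf.differentiableAt (Metric.ball_mem_nhds x hr)).hasFDerivAt).norm_right
  simpa only [dist_eq_norm, hsub] using
    Complex.dist_le_mul_div_pow_of_mapsTo_ball_of_isLittleO hd hmaps hlittle hw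

theorem hasFDerivAt_of_norm_sub_sub_le {f : E → F} {f' : E →L[ℂ] F} {x : E} {C : ℝ}
    (h : ∀ᶠ w in 𝓝 x, ‖f w - f x - f' (w - x)‖ ≤ C * ‖w - x‖ ^ 2) : HasFDerivAt f f' x := by
  rw [hasFDerivAt_iff_isLittleO]
  refine (Asymptotics.IsBigO.of_bound C (g := fun w => ‖w - x‖ ^ 2) ?_).trans_isLittleO ?_
  · simpa only [norm_pow, norm_norm] using h
  · exact Asymptotics.isLittleO_pow_sub_sub x one_lt_two

theorem differentiableOn_of_tendsto_of_norm_le [ProperSpace F] {ι : Type*} {l : Filter ι}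
    [l.NeBot] {f : ι → E → F} {g : E → F} {U : Set E} {M : ℝ} (hU : IsOpen U)
    (hf : ∀ i, DifferentiableOn ℂ (f i) U) (hM : ∀ i, ∀ x ∈ U, ‖f i x‖ ≤ M)
    (hlim : ∀ x ∈ U, Tendsto (fun i => f i x) l (𝓝 (g x))) : DifferentiableOn ℂ g U := by
  intro x hx
  obtain ⟨r, hr, hrU⟩ := Metric.isOpen_iff.1 hU x hx
  have hfr (i : ι) : DifferentiableOn ℂ (f i) (Metric.ball x r) := (hf i).mono hrU
  have hMr (i : ι) : ∀ y ∈ Metric.ball x r, ‖f i y‖ ≤ M := fun y hy => hM i y (hrU hy)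
  have hbound (i : ι) : ‖fderiv ℂ (f i) x‖ ≤ 2 * M / r :=
    norm_fderiv_le_of_norm_le_ball hr (hfr i) (hMr i)
  set u : Ultrafilter ι := Ultrafilter.of l
  have hul : (u : Filter ι) ≤ l := Ultrafilter.of_le l
  -- The derivative of `g` is the limit of the derivatives along an ultrafilter.
  choose L hL using fun v : E => exists_tendsto_ultrafilter_of_norm_le u
    fun i => ContinuousLinearMap.le_of_opNorm_le (fderiv ℂ (f i) x) (hbound i) v
  let L' : E →L[ℂ] F := ContinuousLinearMap.ofTendstoOfBoundedRange (l := (u : Filter ι)) L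
    (fun i => fderiv ℂ (f i) x) (tendsto_pi_nhds.2 hL)
    ((Metric.isBounded_closedBall (x := (0 : E →L[ℂ] F)) (r := 2 * M / r)).subset
      (range_subset_iff.2 fun i => mem_closedBall_zero_iff.2 (hbound i)))
  have hL' : HasFDerivAt g L' x := by
    refine hasFDerivAt_of_norm_sub_sub_le (C := 4 * M / r ^ 2) ?_
    filter_upwards [Metric.ball_mem_nhds x hr] with w hw
    have hconv : Tendsto (fun i => f i w - f i x - fderiv ℂ (f i) x (w - x)) u
        (𝓝 (g w - g x - L' (w - x))) :=
      (((hlim w (hrU hw)).mono_left hul).sub ((hlim x hx).mono_left hul)).sub (hL _)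
    refine le_of_tendsto hconv.norm (Eventually.of_forall fun i => ?_)
    exact (norm_sub_sub_fderiv_le_of_norm_le_ball hr (hfr i) (hMr i) hw).trans_eq (by ring)
  exact hL'.differentiableAt.differentiableWithinAt

theorem differentiableOn_tsum_of_norm_le [ProperSpace F] {ι : Type*} {f : ι → E → F} {U : Set E}
    {b : ι → ℝ} (hU : IsOpen U) (hf : ∀ i, DifferentiableOn ℂ (f i) U) (hb : Summable b)
    (hle : ∀ i, ∀ x ∈ U, ‖f i x‖ ≤ b i) : DifferentiableOn ℂ (fun x => ∑' i, f i x) U := by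
  refine differentiableOn_of_tendsto_of_norm_le (l := (atTop : Filter (Finset ι)))
    (f := fun s x => ∑ i ∈ s, f i x) (M := ∑' i, b i) hU
    (fun s => DifferentiableOn.fun_sum fun i _ => hf i) (fun s x hx => ?_)
    fun x hx => (Summable.of_norm_bounded hb fun i => hle i x hx).hasSum
  exact (norm_sum_le _ _).trans ((Finset.sum_le_sum fun i _ => hle i x hx).trans
    (hb.sum_le_tsum _ fun i _ => (norm_nonneg _).trans (hle i x hx)))

theorem norm_inv_smul_sub_sub_fderiv_le {f : E → F} {x v : E} {r M : ℝ} (hr : 0 < r)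
    (hf : DifferentiableOn ℂ f (Metric.ball x r)) (hM : ∀ y ∈ Metric.ball x r, ‖f y‖ ≤ M) {t : ℂ}
    (ht : t ≠ 0) (htv : ‖t • v‖ < r) :
    ‖t⁻¹ • (f (x + t • v) - f x) - fderiv ℂ f x v‖ ≤ 4 * M * (‖v‖ / r) ^ 2 * ‖t‖ := by
  have h := norm_sub_sub_fderiv_le_of_norm_le_ball hr hf hM (w := x + t • v)
    (by rwa [mem_ball_iff_norm, add_sub_cancel_left])
  rw [add_sub_cancel_left, map_smul, norm_smul] at h
  calc ‖t⁻¹ • (f (x + t • v) - f x) - fderiv ℂ f x v‖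
      = ‖t‖⁻¹ * ‖f (x + t • v) - f x - t • fderiv ℂ f x v‖ := by
        rw [← norm_inv, ← norm_smul, smul_sub _ (_ - _), inv_smul_smul₀ ht]
    _ ≤ ‖t‖⁻¹ * (4 * M * (‖t‖ * ‖v‖ / r) ^ 2) := by gcongr
    _ = 4 * M * (‖v‖ / r) ^ 2 * ‖t‖ := by field [norm_ne_zero_iff.2 ht]

theorem exists_ball_subset_forall_norm_le {X Y : Type*} [PseudoMetricSpace X]
    [SeminormedAddCommGroup Y] {f : X → Y} {U : Set X} {x : X} (hU : U ∈ 𝓝 x)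
    (hf : ContinuousAt f x) :
    ∃ M, ∃ r > 0, Metric.ball x r ⊆ U ∧ ∀ y ∈ Metric.ball x r, ‖f y‖ ≤ M := by
  obtain ⟨r, hr, h⟩ := Metric.mem_nhds_iff.1 (inter_mem hU
    (hf.norm.eventually_le_const (lt_add_one ‖f x‖)))
  exact ⟨‖f x‖ + 1, r, hr, fun y hy => (h hy).1, fun y hy => (h hy).2⟩

theorem differentiableOn_ball_fderiv_apply [ProperSpace F] {f : E → F} {x : E} {r M : ℝ}
    (hr : 0 < r) (hf : DifferentiableOn ℂ f (Metric.ball x (r + r)))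
    (hM : ∀ y ∈ Metric.ball x (r + r), ‖f y‖ ≤ M) (v : E) :
    DifferentiableOn ℂ (fun y => fderiv ℂ f y v) (Metric.ball x r) := by
  have hsub {y : E} (hy : y ∈ Metric.ball x r) : Metric.ball y r ⊆ Metric.ball x (r + r) :=
    Metric.ball_subset_ball' (by linarith [Metric.mem_ball.1 hy])
  have hM0 : 0 ≤ M := (norm_nonneg _).trans (hM x (Metric.mem_ball_self (by positivity)))
  obtain ⟨t, -, ht, htlim⟩ :=
    exists_seq_strictAnti_tendsto' (show 0 < min 1 (r / (‖v‖ + 1)) by positivity)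
  have htn (j : ℕ) : ‖(t j : ℂ)‖ = t j := Complex.norm_of_nonneg (ht j).1.le
  have htv (j : ℕ) : ‖(t j : ℂ) • v‖ < r := by
    rw [norm_smul, htn]
    calc t j * ‖v‖ < t j * (‖v‖ + 1) := mul_lt_mul_of_pos_left (lt_add_one _) (ht j).1
      _ ≤ r := (le_div_iff₀ (by positivity)).1 ((ht j).2.le.trans (min_le_right _ _))
  set q : ℕ → E → F := fun j y => (t j : ℂ)⁻¹ • (f (y + (t j : ℂ) • v) - f y)
  have hclose (j : ℕ) (y : E) (hy : y ∈ Metric.ball x r) :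
      ‖q j y - fderiv ℂ f y v‖ ≤ 4 * M * (‖v‖ / r) ^ 2 * t j :=
    (norm_inv_smul_sub_sub_fderiv_le hr (hf.mono (hsub hy)) (fun w hw => hM w (hsub hy hw))
      (Complex.ofReal_ne_zero.2 (ht j).1.ne') (htv j)).trans_eq (by rw [htn])
  refine differentiableOn_of_tendsto_of_norm_le (l := atTop) (f := q)
    (M := 4 * M * (‖v‖ / r) ^ 2 + 2 * M / r * ‖v‖) Metric.isOpen_ball (fun j => ?_)
    (fun j y hy => ?_) fun y hy => ?_
  · refine ((hf.comp (by fun_prop) fun y hy => hsub hy ?_).sub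
      (hf.mono (Metric.ball_subset_ball (by linarith)))).const_smul _
    rw [mem_ball_iff_norm, add_sub_cancel_left]
    exact htv j
  · have hq := (hclose j y hy).trans (mul_le_of_le_one_right (by positivity)
      ((ht j).2.le.trans (min_le_left _ _)))
    have hD := (fderiv ℂ f y).le_of_opNorm_le
      (norm_fderiv_le_of_norm_le_ball hr (hf.mono (hsub hy)) fun w hw => hM w (hsub hy hw)) v
    linarith [norm_le_norm_sub_add (q j y) (fderiv ℂ f y v)]
  · rw [tendsto_iff_norm_sub_tendsto_zero]
    refine squeeze_zero (fun _ => norm_nonneg _) (fun j => hclose j y hy) ?_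
    simpa only [mul_zero] using htlim.const_mul (4 * M * (‖v‖ / r) ^ 2)

theorem differentiableOn_fderiv_apply [ProperSpace F] {f : E → F} {U : Set E} (hU : IsOpen U)
    (hf : DifferentiableOn ℂ f U) (v : E) : DifferentiableOn ℂ (fun x => fderiv ℂ f x v) U := by
  intro x hx
  obtain ⟨M, R, hR, hRU, hM⟩ := exists_ball_subset_forall_norm_le (hU.mem_nhds hx)
    (hf.differentiableAt (hU.mem_nhds hx)).continuousAt
  obtain ⟨r, rfl⟩ : ∃ r, R = r + r := ⟨R / 2, (add_halves R).symm⟩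
  have hr : 0 < r := pos_add_self_iff.1 hR
  exact ((differentiableOn_ball_fderiv_apply hr (hf.mono hRU) hM v).differentiableAt
    (Metric.ball_mem_nhds x hr)).differentiableWithinAt

theorem iteratedDeriv_succ_comp_line (f : E → F) (v : E) (k : ℕ) (x : E) :
    iteratedDeriv (k + 1) (fun ζ : ℂ => f (x + ζ • v)) 0 =
      lineDeriv ℂ (fun y => iteratedDeriv k (fun ζ : ℂ => f (y + ζ • v)) 0) x v := by
  rw [iteratedDeriv_succ, lineDeriv]
  congr 1
  funext η
  have h := iteratedDeriv_comp_add_const k (fun ζ : ℂ => f (x + ζ • v)) η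
  simp only [add_comm _ η, add_smul, ← add_assoc] at h
  rw [congr_fun h 0, add_zero]

theorem differentiableOn_iteratedDeriv_comp_line [ProperSpace F] {f : E → F} {U : Set E}
    (hU : IsOpen U) (hf : DifferentiableOn ℂ f U) (v : E) (k : ℕ) :
    DifferentiableOn ℂ (fun x => iteratedDeriv k (fun ζ : ℂ => f (x + ζ • v)) 0) U := by
  induction k with
  | zero => simpa only [iteratedDeriv_zero, zero_smul, add_zero] using hf
  | succ k ih =>
    refine (differentiableOn_fderiv_apply hU ih v).congr fun x hx => ?_
    rw [iteratedDeriv_succ_comp_line, (ih.differentiableAt (hU.mem_nhds hx)).lineDeriv_eq_fderiv]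

theorem norm_iteratedDeriv_le_of_norm_le_ball [CompleteSpace F] {f : ℂ → F} {c : ℂ} {r M : ℝ}
    (hr : 0 < r) (hf : DifferentiableOn ℂ f (Metric.ball c r))
    (hM : ∀ z ∈ Metric.ball c r, ‖f z‖ ≤ M) (k : ℕ) :
    ‖iteratedDeriv k f c‖ ≤ k.factorial * M / r ^ k := by
  have hlim : Tendsto (fun s : ℝ => k.factorial * M / s ^ k) (𝓝[<] r)
      (𝓝 (k.factorial * M / r ^ k)) :=
    (tendsto_const_nhds.div ((continuous_pow k).tendsto r) (by positivity)).mono_left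
      nhdsWithin_le_nhds
  refine ge_of_tendsto hlim ?_
  filter_upwards [Ioo_mem_nhdsLT hr] with s hs
  have hsub : Metric.closedBall c s ⊆ Metric.ball c r := Metric.closedBall_subset_ball hs.2
  exact Complex.norm_iteratedDeriv_le_of_forall_mem_sphere_norm_le k hs.1
    ((hf.mono hsub).diffContOnCl_ball subset_rfl)
    fun z hz => hM z (hsub (Metric.sphere_subset_closedBall hz))

/-- Montel's theorem for pointwise convergence: `g` is the limit of `f` along an ultrafilter. -/
theorem exists_differentiableOn_of_norm_le [ProperSpace F] {f : ℕ → E → F} {U : Set E} {M : ℝ}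
    (hU : IsOpen U) (hf : ∀ n, DifferentiableOn ℂ (f n) U) (hM : ∀ n, ∀ x ∈ U, ‖f n x‖ ≤ M) :
    ∃ g : E → F, DifferentiableOn ℂ g U ∧ (∀ x ∈ U, ‖g x‖ ≤ M) ∧
      ∀ x ∈ U, ∀ a, Tendsto (fun n => f n x) atTop (𝓝 a) → g x = a := by
  set u : Ultrafilter ℕ := Ultrafilter.of atTop
  have hex (x : E) : ∃ a, x ∈ U → Tendsto (fun n => f n x) u (𝓝 a) := by
    by_cases hx : x ∈ U
    · obtain ⟨a, ha⟩ := exists_tendsto_ultrafilter_of_norm_le u fun n => hM n x hx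
      exact ⟨a, fun _ => ha⟩
    · exact ⟨0, fun h => (hx h).elim⟩
  choose g hg using hex
  refine ⟨g, differentiableOn_of_tendsto_of_norm_le hU hf hM hg, fun x hx => ?_,
    fun x hx a ha => ?_⟩
  · exact le_of_tendsto (hg x hx).norm (Eventually.of_forall fun n => hM n x hx)
  · exact tendsto_nhds_unique (hg x hx) (ha.mono_left (Ultrafilter.of_le _))

end Limits

section Truncation

theorem CZero.norm_apply_le (x : CZero) (i : ℕ) : ‖x i‖ ≤ ‖x‖ := x.toBCF.norm_coe_le_norm i

theorem CZero.norm_le {x : CZero} {C : ℝ} (hC : 0 ≤ C) (h : ∀ i, ‖x i‖ ≤ C) : ‖x‖ ≤ C :=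
  (BoundedContinuousFunction.norm_le (f := x.toBCF) hC).2 h

/-- The truncation of an arbitrary sequence to its first `n` entries, as an element of `c₀`; it is
defined on all sequences, so that it also sends `𝕋^∞` and `ℓ_∞` into `c₀`. -/
def trunc (n : ℕ) : (ℕ → ℂ) →ₗ[ℂ] CZero where
  toFun u :=
    { toFun := fun i => if i < n then u i else 0
      continuous_toFun := continuous_of_discreteTopology
      zero_at_infty' := by
        rw [cocompact_eq_atTop]
        refine tendsto_const_nhds.congr' ?_
        filter_upwards [eventually_ge_atTop n] with i hi
        rw [if_neg (not_lt.2 hi)] }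
  map_add' u v := by
    ext i
    change (if i < n then u i + v i else 0) = (if i < n then u i else 0) + if i < n then v i else 0
    split_ifs <;> simp only [add_zero]
  map_smul' c u := by
    ext i
    change (if i < n then c • u i else 0) = c • (if i < n then u i else 0)
    split_ifs <;> simp only [smul_zero]

theorem trunc_apply (n : ℕ) (u : ℕ → ℂ) (i : ℕ) : trunc n u i = if i < n then u i else 0 := rfl

theorem trunc_apply_of_le {n i : ℕ} (hi : n ≤ i) (u : ℕ → ℂ) : trunc n u i = 0 :=
  if_neg (not_lt.2 hi)

theorem norm_trunc_le {n : ℕ} {u : ℕ → ℂ} {C : ℝ} (hC : 0 ≤ C) (h : ∀ i < n, ‖u i‖ ≤ C) :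
    ‖trunc n u‖ ≤ C := by
  refine CZero.norm_le hC fun i => ?_
  rw [trunc_apply]
  split_ifs with hi
  · exact h i hi
  · rwa [norm_zero]

theorem norm_trunc_coe_le (n : ℕ) (x : CZero) : ‖trunc n x‖ ≤ ‖x‖ :=
  norm_trunc_le (norm_nonneg x) fun i _ => x.norm_apply_le i

theorem trunc_eq_self {n : ℕ} {x : CZero} (h : ∀ i, n ≤ i → x i = 0) : trunc n x = x := by
  ext i
  rw [trunc_apply]
  split_ifs with hi
  · rfl
  · exact (h i (not_lt.1 hi)).symm

theorem tendsto_trunc (x : CZero) : Tendsto (fun n => trunc n x) atTop (𝓝 x) := by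
  have hx : Tendsto (fun i => x i) atTop (𝓝 0) := by
    rw [← cocompact_eq_atTop]; exact x.zero_at_infty'
  refine Metric.tendsto_atTop.2 fun ε hε => ?_
  obtain ⟨N, hN⟩ := Metric.tendsto_atTop.1 hx (ε / 2) (half_pos hε)
  refine ⟨N, fun n hn => ?_⟩
  rw [dist_eq_norm]
  refine (CZero.norm_le (half_pos hε).le fun i => ?_).trans_lt (half_lt_self hε)
  change ‖trunc n x i - x i‖ ≤ _
  rw [trunc_apply]
  split_ifs with hi
  · rw [sub_self, norm_zero]; exact (half_pos hε).le
  · simpa only [zero_sub, norm_neg, dist_zero_right] using (hN i (hn.trans (not_lt.1 hi))).le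

/-- Truncation as a contraction of `c₀`. -/
def truncL (n : ℕ) : CZero →L[ℂ] CZero :=
  LinearMap.mkContinuous
    { toFun := fun x => trunc n x
      map_add' := fun x y => (trunc n).map_add x y
      map_smul' := fun c x => (trunc n).map_smul c x } 1
    fun x => (norm_trunc_coe_le n x).trans_eq (one_mul _).symm

/-- The unit vectors of `c₀`. -/
def unitVec (i : ℕ) : CZero := trunc (i + 1) (Pi.single i 1)

theorem unitVec_apply (i j : ℕ) : unitVec i j = if j = i then 1 else 0 := by
  rw [unitVec, trunc_apply, Pi.single_apply]
  split_ifs <;> first | rfl | omega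

theorem trunc_eq_sum (n : ℕ) (u : ℕ → ℂ) :
    trunc n u = ∑ i ∈ Finset.range n, u i • unitVec i := by
  induction n with
  | zero => ext i; simp [trunc_apply]
  | succ n ih =>
    rw [Finset.sum_range_succ, ← ih]
    ext i
    change _ = trunc n u i + u n * unitVec n i
    simp only [trunc_apply, unitVec_apply]
    split_ifs <;> first | omega | simp_all

/-- The coordinate functionals on `c₀`. -/
def coord (i : ℕ) : CZero →L[ℂ] ℂ :=
  LinearMap.mkContinuous
    { toFun := fun x => x i
      map_add' := fun _ _ => rfl
      map_smul' := fun _ _ => rfl } 1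
    fun x => (x.norm_apply_le i).trans_eq (one_mul _).symm

/-- The truncation of a point of the unit ball of `c₀`. -/
def truncBall (n : ℕ) (z : CZeroBall) : CZeroBall :=
  ⟨trunc n (z : CZero), mem_ball_zero_iff.2
    ((norm_trunc_coe_le n _).trans_lt (mem_ball_zero_iff.1 z.2))⟩

theorem tendsto_truncBall (z : CZeroBall) : Tendsto (fun n => truncBall n z) atTop (𝓝 z) :=
  tendsto_subtype_rng.2 (tendsto_trunc (z : CZero))

theorem IsMonomialCoeff.eq {g h : HInfBall} {c : (ℕ →₀ ℕ) → ℂ} (hg : IsMonomialCoeff g c)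
    (hh : IsMonomialCoeff h c) : g = h := by
  have key (n : ℕ) (z : CZeroBall) :
      (g : CZeroBall →ᵇ ℂ) (truncBall n z) = (h : CZeroBall →ᵇ ℂ) (truncBall n z) := by
    have hz (i : ℕ) (hi : n ≤ i) : (truncBall n z : CZero) i = 0 := trunc_apply_of_le hi _
    exact (hg n _ hz).unique (hh n _ hz)
  refine Subtype.ext (BoundedContinuousFunction.ext fun z => ?_)
  have hlim (f : CZeroBall →ᵇ ℂ) : Tendsto (fun n => f (truncBall n z)) atTop (𝓝 (f z)) :=
    (f.continuous.tendsto z).comp (tendsto_truncBall z)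
  exact tendsto_nhds_unique (hlim g) ((hlim h).congr fun n => (key n z).symm)

end Truncation

section Monomials

/-- The monomial `u ^ α`. -/
def monomial {R : Type*} [CommSemiring R] (u : ℕ → R) (α : ℕ →₀ ℕ) : R := α.prod fun i a => u i ^ a

variable {R : Type*} [CommSemiring R]

theorem monomial_add (u : ℕ → R) (α β : ℕ →₀ ℕ) :
    monomial u (α + β) = monomial u α * monomial u β :=
  Finsupp.prod_add_index' (fun _ => pow_zero _) fun _ _ _ => pow_add _ _ _

theorem monomial_zero (u : ℕ → R) : monomial u 0 = 1 := Finsupp.prod_zero_index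

theorem monomial_single (u : ℕ → R) (i k : ℕ) : monomial u (Finsupp.single i k) = u i ^ k :=
  Finsupp.prod_single_index (pow_zero _)

theorem monomial_mul (u v : ℕ → R) (α : ℕ →₀ ℕ) :
    monomial (fun i => u i * v i) α = monomial u α * monomial v α := by
  simp only [monomial, Finsupp.prod, mul_pow, Finset.prod_mul_distrib]

theorem monomial_const (r : R) (α : ℕ →₀ ℕ) : monomial (fun _ => r) α = r ^ α.degree := by
  simp only [monomial, Finsupp.prod, Finset.prod_pow_eq_pow_sum, Finsupp.degree_apply]

theorem monomial_congr {u v : ℕ → R} {α : ℕ →₀ ℕ} (h : ∀ i, α i ≠ 0 → u i = v i) :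
    monomial u α = monomial v α :=
  Finsupp.prod_congr fun i hi => by rw [h i (Finsupp.mem_support_iff.1 hi)]

theorem monomial_eq_zero {u : ℕ → R} {α : ℕ →₀ ℕ} {i : ℕ} (hi : α i ≠ 0) (hu : u i = 0) :
    monomial u α = 0 :=
  Finset.prod_eq_zero (Finsupp.mem_support_iff.2 hi) (by simp only [hu, ne_eq, hi,
    not_false_eq_true, zero_pow])

theorem norm_monomial (u : ℕ → ℂ) (α : ℕ →₀ ℕ) : ‖monomial u α‖ = monomial (fun i => ‖u i‖) α := by
  simp only [monomial, Finsupp.prod, norm_prod, norm_pow]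

theorem norm_monomial_le {u : ℕ → ℂ} {r : ℕ → ℝ} (h : ∀ i, ‖u i‖ ≤ r i) (α : ℕ →₀ ℕ) :
    ‖monomial u α‖ ≤ monomial r α := by
  rw [norm_monomial]
  exact Finset.prod_le_prod (fun i _ => by positivity) fun i _ =>
    pow_le_pow_left₀ (norm_nonneg _) (h i) _

open Classical in
theorem monomial_trunc (n : ℕ) (u : ℕ → ℂ) (α : ℕ →₀ ℕ) :
    monomial (trunc n u) α = if ∀ i, n ≤ i → α i = 0 then monomial u α else 0 := by
  split_ifs with h
  · exact monomial_congr fun i hi => if_pos (not_le.1 fun hn => hi (h i hn))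
  · push Not at h
    obtain ⟨i, hi, hα⟩ := h
    exact monomial_eq_zero hα (trunc_apply_of_le hi u)

theorem differentiable_monomial_trunc (n : ℕ) (α : ℕ →₀ ℕ) :
    Differentiable ℂ fun x : CZero => monomial (trunc n x) α := by
  have h (i : ℕ) : ContDiff ℂ 1 fun x : CZero => trunc n x i :=
    ((coord i).comp (truncL n)).contDiff
  exact (contDiff_prod fun i _ => (h i).pow _).differentiable one_ne_zero

theorem sum_monomial_finsupp (s : Finset ℕ) (N : ℕ) (u : ℕ → R) :
    ∑ α ∈ s.finsupp (fun _ => Finset.range N), monomial u α =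
      ∏ i ∈ s, ∑ k ∈ Finset.range N, u i ^ k := by
  classical
  rw [Finset.prod_sum, Finset.finsupp, Finset.sum_map]
  refine Finset.sum_congr (by congr!) fun p _ => ?_
  change (Finsupp.indicator s p).prod (fun i a => u i ^ a) = _
  rw [Finsupp.prod_of_support_subset _ (Finsupp.support_indicator_subset _ _) _
    fun i _ => pow_zero _, ← Finset.prod_attach]
  refine Finset.prod_congr rfl fun i _ => ?_
  rw [Finsupp.indicator_of_mem i.2]

theorem summable_monomial {n : ℕ} {r : ℕ → ℝ} (h0 : ∀ i, 0 ≤ r i) (h1 : ∀ i, r i < 1)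
    (hn : ∀ i, n ≤ i → r i = 0) : Summable (monomial r) := by
  have hnonneg (α : ℕ →₀ ℕ) : 0 ≤ monomial r α := Finset.prod_nonneg fun i _ => pow_nonneg (h0 i) _
  refine summable_of_sum_le (c := ∏ i ∈ Finset.range n, (1 - r i)⁻¹) hnonneg fun S => ?_
  set N : ℕ := S.sup (fun α => α.degree) + 1
  have hsub : S.filter (monomial r · ≠ 0) ⊆ (Finset.range n).finsupp fun _ => Finset.range N := by
    intro α hα
    rw [Finset.mem_filter] at hα
    refine Finset.mem_finsupp_iff.2 ⟨fun i hi => Finset.mem_range.2 ?_, fun i _ =>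
      Finset.mem_range.2 (Nat.lt_succ_of_le ((Finsupp.le_degree i α).trans
        (Finset.le_sup (f := fun α : ℕ →₀ ℕ => α.degree) hα.1)))⟩
    exact not_le.1 fun hni => hα.2 (monomial_eq_zero (Finsupp.mem_support_iff.1 hi) (hn i hni))
  calc ∑ α ∈ S, monomial r α
      = ∑ α ∈ S with monomial r α ≠ 0, monomial r α := (Finset.sum_filter_ne_zero S).symm
    _ ≤ ∑ α ∈ (Finset.range n).finsupp fun _ => Finset.range N, monomial r α :=
        Finset.sum_le_sum_of_subset_of_nonneg hsub fun α _ _ => hnonneg α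
    _ = ∏ i ∈ Finset.range n, ∑ k ∈ Finset.range N, r i ^ k := sum_monomial_finsupp _ _ _
    _ ≤ ∏ i ∈ Finset.range n, (1 - r i)⁻¹ := by
        refine Finset.prod_le_prod (fun i _ => Finset.sum_nonneg fun k _ => pow_nonneg (h0 i) k)
          fun i _ => ?_
        rw [← tsum_geometric_of_lt_one (h0 i) (h1 i)]
        exact (summable_geometric_of_lt_one (h0 i) (h1 i)).sum_le_tsum _
          fun k _ => pow_nonneg (h0 i) k

theorem summable_norm_monomial {n : ℕ} {u : ℕ → ℂ} (h1 : ∀ i, ‖u i‖ < 1)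
    (hn : ∀ i, n ≤ i → u i = 0) : Summable fun α : ℕ →₀ ℕ => ‖monomial u α‖ := by
  simp_rw [norm_monomial]
  exact summable_monomial (fun _ => norm_nonneg _) h1 fun i hi => by rw [hn i hi, norm_zero]

theorem summable_norm_monomial_trunc {x : CZero} (hx : ‖x‖ < 1) (n : ℕ) :
    Summable fun α => ‖monomial (trunc n x) α‖ :=
  summable_norm_monomial
    (fun i => (((trunc n x).norm_apply_le i).trans (norm_trunc_coe_le n x)).trans_lt hx)
    fun _ hi => trunc_apply_of_le hi _

end Monomials

section Fourier

theorem torusMonomial_zero (w : Torus) : torusMonomial 0 w = 1 := Finsupp.prod_zero_index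

theorem torusMonomial_add (α β : ℕ →₀ ℤ) (w : Torus) :
    torusMonomial (α + β) w = torusMonomial α w * torusMonomial β w :=
  Finsupp.prod_add_index' (fun _ => zpow_zero _) fun _ _ _ => zpow_add₀ (Circle.coe_ne_zero _) _ _

theorem torusMonomial_neg (α : ℕ →₀ ℤ) (w : Torus) :
    torusMonomial (-α) w = starRingEnd ℂ (torusMonomial α w) := by
  have h : torusMonomial (-α) w * torusMonomial α w = 1 := by
    rw [← torusMonomial_add, neg_add_cancel, torusMonomial_zero]
  rw [eq_inv_of_mul_eq_one_left h, Complex.inv_def, Complex.normSq_eq_norm_sq, norm_torusMonomial]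
  simp

theorem torusMonomial_single (i : ℕ) (k : ℤ) (w : Torus) :
    torusMonomial (Finsupp.single i k) w = (w i : ℂ) ^ k :=
  Finsupp.prod_single_index (zpow_zero _)

theorem torusMonomial_mul (α : ℕ →₀ ℤ) (u w : Torus) :
    torusMonomial α (u * w) = torusMonomial α u * torusMonomial α w := by
  simp only [torusMonomial, Finsupp.prod, Pi.mul_apply, Circle.coe_mul, mul_zpow,
    Finset.prod_mul_distrib]

theorem continuous_torusMonomial (α : ℕ →₀ ℤ) : Continuous (torusMonomial α) :=
  continuous_finsetProd _ fun i _ => (continuous_subtype_val.comp (continuous_apply i)).zpow₀ _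
    fun w => Or.inl (Circle.coe_ne_zero (w i))

theorem toIntIndex_apply (α : ℕ →₀ ℕ) (i : ℕ) : toIntIndex α i = α i := rfl

theorem toIntIndex_injective : Function.Injective toIntIndex :=
  Finsupp.mapRange_injective _ rfl Nat.cast_injective

theorem toIntIndex_zero : toIntIndex 0 = 0 := Finsupp.mapRange_zero

theorem toIntIndex_add (α β : ℕ →₀ ℕ) : toIntIndex (α + β) = toIntIndex α + toIntIndex β :=
  Finsupp.mapRange_add Nat.cast_add _ _

theorem toIntIndex_single (i k : ℕ) :
    toIntIndex (Finsupp.single i k) = Finsupp.single i (k : ℤ) :=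
  Finsupp.mapRange_single

theorem exists_toIntIndex_eq {α : ℕ →₀ ℤ} (h : ∀ i, 0 ≤ α i) : ∃ β, toIntIndex β = α :=
  ⟨α.mapRange Int.toNat rfl, Finsupp.ext fun i => Int.toNat_of_nonneg (h i)⟩

theorem torusMonomial_toIntIndex (α : ℕ →₀ ℕ) (w : Torus) :
    torusMonomial (toIntIndex α) w = monomial (fun i => (w i : ℂ)) α := by
  rw [torusMonomial, toIntIndex, Finsupp.prod_mapRange_index fun _ => zpow_zero _]
  simp only [zpow_natCast, monomial]

theorem circleMeasure_map_mul (u : Circle) :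
    circleMeasure.map (fun c => u * c) = circleMeasure := by
  obtain ⟨a, rfl⟩ : ∃ a : AddCircle (1 : ℝ), AddCircle.toCircle a = u := by
    obtain ⟨a, ha⟩ := (AddCircle.homeomorphCircle (one_ne_zero (α := ℝ))).surjective u
    exact ⟨a, by rwa [AddCircle.homeomorphCircle_apply] at ha⟩
  have hm : Measurable (AddCircle.toCircle (T := (1 : ℝ))) :=
    AddCircle.continuous_toCircle.measurable
  have hcomm : (fun c => AddCircle.toCircle a * c) ∘ AddCircle.toCircle (T := (1 : ℝ)) =
      AddCircle.toCircle ∘ fun x => a + x :=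
    funext fun x => (AddCircle.toCircle_add a x).symm
  rw [circleMeasure, Measure.map_map (continuous_const_mul _).measurable hm, hcomm,
    ← Measure.map_map hm (measurable_const_add a), map_add_left_eq_self]

theorem torusMeasure_map_mul (u : Torus) : torusMeasure.map (fun w => u * w) = torusMeasure := by
  have h := Measure.infinitePi_map_pi (fun _ : ℕ => circleMeasure)
    (f := fun i c => u i * c) fun i => (continuous_const_mul (u i)).measurable
  simp only [circleMeasure_map_mul] at h
  exact h

theorem exists_torusMonomial_eq_neg_one {α : ℕ →₀ ℤ} (hα : α ≠ 0) :
    ∃ u : Torus, torusMonomial α u = -1 := by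
  obtain ⟨j, hj⟩ := DFunLike.ne_iff.1 hα
  set v : Circle := Circle.exp (Real.pi / α j) with hv
  have hvj : (v : ℂ) ^ α j = -1 := by
    have hπ : ((α j • (Real.pi / (α j : ℝ)) : ℝ) : ℂ) = Real.pi := by
      rw [zsmul_eq_mul, mul_div_cancel₀ _ (by exact_mod_cast hj)]
    rw [hv, ← Circle.coe_zpow, ← Circle.exp_zsmul, Circle.coe_exp, hπ, Complex.exp_pi_mul_I]
  refine ⟨Function.update 1 j v, ?_⟩
  rw [torusMonomial, Finsupp.prod, Finset.prod_eq_single j]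
  · rw [Function.update_self, hvj]
  · intro i _ hij
    rw [Function.update_of_ne hij, Pi.one_apply, Circle.coe_one, one_zpow]
  · exact fun h => (h (Finsupp.mem_support_iff.2 hj)).elim

/-- Rotating the torus by a point where `w ^ α = -1` shows that the integral of a non-constant
monomial equals its negative. -/
theorem integral_torusMonomial (α : ℕ →₀ ℤ) :
    ∫ w, torusMonomial α w ∂torusMeasure = if α = 0 then 1 else 0 := by
  split_ifs with h
  · simp [h, torusMonomial_zero]
  obtain ⟨u, hu⟩ := exists_torusMonomial_eq_neg_one h
  refine self_eq_neg.1 ?_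
  calc ∫ w, torusMonomial α w ∂torusMeasure
      = ∫ w, torusMonomial α (u * w) ∂torusMeasure := by
        conv_lhs => rw [← torusMeasure_map_mul u]
        exact integral_map (by fun_prop) (continuous_torusMonomial α).aestronglyMeasurable
    _ = -∫ w, torusMonomial α w ∂torusMeasure := by
        simp only [torusMonomial_mul, hu, neg_one_mul, integral_neg]

/-- The Fourier coefficient of a function on `𝕋^∞`; `fourierCoeff` is its restriction to
`L_∞(𝕋^∞)`. -/
def torusCoeff (f : Torus → ℂ) (α : ℕ →₀ ℤ) : ℂ := ∫ w, f w * torusMonomial (-α) w ∂torusMeasure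

theorem torusCoeff_congr_ae {f g : Torus → ℂ} (h : f =ᵐ[torusMeasure] g) (α : ℕ →₀ ℤ) :
    torusCoeff f α = torusCoeff g α :=
  integral_congr_ae (h.mono fun w hw => by simp only [hw])

theorem torusCoeff_const_mul (c : ℂ) (f : Torus → ℂ) (α : ℕ →₀ ℤ) :
    torusCoeff (fun w => c * f w) α = c * torusCoeff f α := by
  simp only [torusCoeff, mul_assoc, integral_const_mul]

theorem torusCoeff_torusMonomial (α β : ℕ →₀ ℤ) :
    torusCoeff (torusMonomial α) β = if α = β then 1 else 0 := by
  simp only [torusCoeff, ← torusMonomial_add, integral_torusMonomial, ← sub_eq_add_neg, sub_eq_zero]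

theorem integrable_mul_torusMonomial' {f : Torus → ℂ} (hf : Integrable f torusMeasure)
    (α : ℕ →₀ ℤ) : Integrable (fun w => f w * torusMonomial α w) torusMeasure :=
  hf.mul_bdd (c := 1) (continuous_torusMonomial α).aestronglyMeasurable
    (Eventually.of_forall fun w => (norm_torusMonomial α w).le)

theorem norm_torusCoeff_le {f : Torus → ℂ} {C : ℝ} (hf : ∀ᵐ w ∂torusMeasure, ‖f w‖ ≤ C)
    (α : ℕ →₀ ℤ) : ‖torusCoeff f α‖ ≤ C := by
  refine (norm_integral_le_of_norm_le_const (C := C) ?_).trans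
    (by rw [probReal_univ, mul_one])
  filter_upwards [hf] with w hw
  rwa [norm_mul, norm_torusMonomial, mul_one]

/-- The monomial `w ^ α` as a continuous function on `𝕋^∞`. -/
def torusMonomialC (α : ℕ →₀ ℤ) : C(Torus, ℂ) := ⟨torusMonomial α, continuous_torusMonomial α⟩

/-- The star algebra of trigonometric polynomials on `𝕋^∞`. -/
def trigSubalgebra : StarSubalgebra ℂ C(Torus, ℂ) where
  toSubalgebra := Algebra.adjoin ℂ (range torusMonomialC)
  star_mem' := by
    change Algebra.adjoin ℂ (range torusMonomialC) ≤ star (Algebra.adjoin ℂ (range torusMonomialC))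
    refine Algebra.adjoin_le ?_
    rintro - ⟨α, rfl⟩
    exact Algebra.subset_adjoin ⟨-α, ContinuousMap.ext fun w => torusMonomial_neg α w⟩

theorem trigSubalgebra_toSubmodule :
    Subalgebra.toSubmodule trigSubalgebra.toSubalgebra =
      Submodule.span ℂ (range torusMonomialC) := by
  apply Algebra.adjoin_eq_span_of_subset
  refine Subset.trans (fun x hx => ?_) Submodule.subset_span
  refine Submonoid.closure_induction (fun _ => id) ⟨0, ?_⟩ ?_ hx
  · exact ContinuousMap.ext torusMonomial_zero
  · rintro - - - - ⟨α, rfl⟩ ⟨β, rfl⟩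
    exact ⟨α + β, ContinuousMap.ext fun w => torusMonomial_add α β w⟩

theorem trigSubalgebra_separatesPoints : trigSubalgebra.SeparatesPoints := by
  intro x y hxy
  obtain ⟨i, hi⟩ := Function.ne_iff.1 hxy
  refine ⟨_, ⟨torusMonomialC (Finsupp.single i 1), Algebra.subset_adjoin ⟨_, rfl⟩, rfl⟩, ?_⟩
  change torusMonomial _ x ≠ torusMonomial _ y
  rw [torusMonomial_single, torusMonomial_single, zpow_one, zpow_one]
  exact fun h => hi (Circle.ext h)

theorem topologicalClosure_span_torusMonomialC :
    (Submodule.span ℂ (range torusMonomialC)).topologicalClosure = ⊤ := by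
  rw [← trigSubalgebra_toSubmodule]
  exact congr_arg (Subalgebra.toSubmodule <| StarSubalgebra.toSubalgebra ·)
    (ContinuousMap.starSubalgebra_topologicalClosure_eq_top_of_separatesPoints trigSubalgebra
      trigSubalgebra_separatesPoints)

/-- The monomial `w ^ α` as an element of `L²(𝕋^∞)`. -/
def torusMonomialLp (α : ℕ →₀ ℤ) : Lp ℂ 2 torusMeasure :=
  ContinuousMap.toLp (E := ℂ) 2 torusMeasure ℂ (torusMonomialC α)

theorem coeFn_torusMonomialLp (α : ℕ →₀ ℤ) :
    torusMonomialLp α =ᵐ[torusMeasure] torusMonomial α :=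
  ContinuousMap.coeFn_toLp torusMeasure (torusMonomialC α)

theorem inner_torusMonomialLp (α : ℕ →₀ ℤ) (f : Lp ℂ 2 torusMeasure) :
    inner ℂ (torusMonomialLp α) f = torusCoeff f α := by
  rw [L2.inner_def]
  refine integral_congr_ae ?_
  filter_upwards [coeFn_torusMonomialLp α] with w hw
  rw [hw, torusMonomial_neg, RCLike.inner_apply]

theorem orthonormal_torusMonomialLp : Orthonormal ℂ torusMonomialLp := by
  refine orthonormal_iff_ite.2 fun α β => ?_
  rw [inner_torusMonomialLp, torusCoeff_congr_ae (coeFn_torusMonomialLp β),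
    torusCoeff_torusMonomial]
  simp only [eq_comm]

theorem topologicalClosure_span_torusMonomialLp :
    (Submodule.span ℂ (range torusMonomialLp)).topologicalClosure = ⊤ := by
  convert!
    (ContinuousMap.toLp_denseRange ℂ torusMeasure ℂ (p := 2)
      (by simp)).topologicalClosure_map_submodule topologicalClosure_span_torusMonomialC
  rw [Submodule.map_span]
  unfold torusMonomialLp
  rw [range_comp']
  simp only [ContinuousLinearMap.coe_coe]

/-- The monomials as a Hilbert basis of `L²(𝕋^∞)`. -/
def torusBasis : HilbertBasis (ℕ →₀ ℤ) ℂ (Lp ℂ 2 torusMeasure) :=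
  HilbertBasis.mk orthonormal_torusMonomialLp topologicalClosure_span_torusMonomialLp.ge

theorem torusBasis_repr (f : Lp ℂ 2 torusMeasure) (α : ℕ →₀ ℤ) :
    torusBasis.repr f α = torusCoeff f α := by
  rw [HilbertBasis.repr_apply_apply, ← inner_torusMonomialLp, torusBasis, HilbertBasis.coe_mk]

theorem ae_eq_of_torusCoeff_eq {f g : Torus → ℂ} (hf : MemLp f 2 torusMeasure)
    (hg : MemLp g 2 torusMeasure) (h : ∀ α, torusCoeff f α = torusCoeff g α) :
    f =ᵐ[torusMeasure] g := by
  have heq : hf.toLp f = hg.toLp g := by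
    refine torusBasis.repr.injective (lp.ext (funext fun α => ?_))
    rw [torusBasis_repr, torusBasis_repr, torusCoeff_congr_ae hf.coeFn_toLp,
      torusCoeff_congr_ae hg.coeFn_toLp, h]
  exact hf.coeFn_toLp.symm.trans (heq ▸ hg.coeFn_toLp)

theorem LInfTorus.ext_fourierCoeff {f g : LInfTorus}
    (h : ∀ α, fourierCoeff f α = fourierCoeff g α) : f = g :=
  Lp.ext (ae_eq_of_torusCoeff_eq ((Lp.memLp f).mono_exponent le_top)
    ((Lp.memLp g).mono_exponent le_top) h)

theorem HInfTorus.ext_hardyCoeff {f g : HInfTorus} (h : ∀ α, hardyCoeff f α = hardyCoeff g α) :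
    f = g := by
  refine Subtype.ext (LInfTorus.ext_fourierCoeff fun α => ?_)
  by_cases hα : ∀ i, 0 ≤ α i
  · obtain ⟨β, rfl⟩ := exists_toIntIndex_eq hα
    exact h β
  · rw [f.2 α hα, g.2 α hα]

theorem LInfTorus.ae_norm_le (f : LInfTorus) : ∀ᵐ w ∂torusMeasure, ‖f w‖ ≤ ‖f‖ := by
  filter_upwards [ae_le_eLpNormEssSup (f := f) (μ := torusMeasure)] with w hw
  rw [Lp.norm_def, ← toReal_enorm]
  exact ENNReal.toReal_mono (Lp.memLp f).2.ne (hw.trans_eq eLpNorm_exponent_top.symm)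

theorem LInfTorus.norm_le {f : LInfTorus} {C : ℝ} (hC : 0 ≤ C)
    (h : ∀ᵐ w ∂torusMeasure, ‖f w‖ ≤ C) : ‖f‖ ≤ C :=
  (Lp.norm_le_of_ae_bound hC h).trans_eq (by simp)

theorem norm_hardyCoeff_le (f : HInfTorus) (α : ℕ →₀ ℕ) : ‖hardyCoeff f α‖ ≤ ‖f‖ :=
  norm_torusCoeff_le (LInfTorus.ae_norm_le f) _

end Fourier

section Poisson

theorem hasSum_mul_of_summable_norm {ι κ R : Type*} [NormedRing R] [CompleteSpace R] {f : ι → R}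
    {g : κ → R} (hf : Summable fun i => ‖f i‖) (hg : Summable fun i => ‖g i‖) :
    HasSum (fun p : ι × κ => f p.1 * g p.2) ((∑' i, f i) * ∑' i, g i) := by
  rw [tsum_mul_tsum_of_summable_norm hf hg]
  exact (summable_mul_of_summable_norm hf hg).hasSum

/-- The Szegő kernel of the polydisc. -/
def szego (z : ℕ → ℂ) (w : Torus) : ℂ :=
  ∑' α : ℕ →₀ ℕ, starRingEnd ℂ (monomial z α) * torusMonomial (toIntIndex α) w

variable {z : ℕ → ℂ}

theorem summable_norm_monomial_sq (hz : Summable fun α => ‖monomial z α‖) :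
    Summable fun α => ‖monomial z α‖ ^ 2 := by
  simp_rw [pow_two]
  exact (hz.mul_of_nonneg hz (fun _ => norm_nonneg _) fun _ => norm_nonneg _).comp_injective
    (i := fun α => (α, α)) fun _ _ h => (Prod.mk.inj h).1

theorem hasSum_norm_szego_sq (hz : Summable fun α => ‖monomial z α‖) (w : Torus) :
    HasSum (fun p : (ℕ →₀ ℕ) × (ℕ →₀ ℕ) => starRingEnd ℂ (monomial z p.1) * monomial z p.2 *
      torusMonomial (toIntIndex p.1 - toIntIndex p.2) w) ((‖szego z w‖ ^ 2 : ℝ) : ℂ) := by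
  set t : (ℕ →₀ ℕ) → ℂ := fun α => starRingEnd ℂ (monomial z α) * torusMonomial (toIntIndex α) w
  have hnorm : Summable fun α => ‖t α‖ := by
    simpa only [t, norm_mul, RCLike.norm_conj, norm_torusMonomial, mul_one] using hz
  have hnorm' : Summable fun α => ‖starRingEnd ℂ (t α)‖ := by simpa only [RCLike.norm_conj]
  have hprod := hasSum_mul_of_summable_norm hnorm hnorm'
  rw [← Complex.conj_tsum] at hprod
  rw [← Complex.normSq_eq_norm_sq, ← Complex.mul_conj]
  refine hprod.congr_fun fun p => ?_
  simp only [t, map_mul, Complex.conj_conj, ← torusMonomial_neg, sub_eq_add_neg, torusMonomial_add]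
  ring

theorem hasSum_integral_mul_norm_szego_sq {f : Torus → ℂ} (hf : Integrable f torusMeasure)
    (hz : Summable fun α => ‖monomial z α‖) :
    HasSum (fun p : (ℕ →₀ ℕ) × (ℕ →₀ ℕ) => starRingEnd ℂ (monomial z p.1) * monomial z p.2 *
      torusCoeff f (toIntIndex p.2 - toIntIndex p.1))
      (∫ w, f w * ((‖szego z w‖ ^ 2 : ℝ) : ℂ) ∂torusMeasure) := by
  set F : (ℕ →₀ ℕ) × (ℕ →₀ ℕ) → Torus → ℂ := fun p w =>
    f w * (starRingEnd ℂ (monomial z p.1) * monomial z p.2 *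
      torusMonomial (toIntIndex p.1 - toIntIndex p.2) w) with hF
  have hnorm (p w) : ‖F p w‖ = ‖monomial z p.1‖ * ‖monomial z p.2‖ * ‖f w‖ := by
    simp only [hF, norm_mul, norm_torusMonomial, mul_one, RCLike.norm_conj]; ring
  have hint (p) : Integrable (F p) torusMeasure :=
    hf.mul_bdd (c := ‖monomial z p.1‖ * ‖monomial z p.2‖)
      ((continuous_torusMonomial _).aestronglyMeasurable.const_mul _)
      (Eventually.of_forall fun w => by simp [norm_torusMonomial])
  have hsum := hasSum_integral_of_summable_integral_norm hint (by
    simp only [hnorm, integral_const_mul]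
    exact (hz.mul_of_nonneg hz (fun _ => norm_nonneg _) fun _ => norm_nonneg _).mul_right _)
  have htsum (w : Torus) : ∑' p, F p w = f w * ((‖szego z w‖ ^ 2 : ℝ) : ℂ) :=
    ((hasSum_norm_szego_sq hz w).mul_left (f w)).tsum_eq
  simp only [htsum] at hsum
  refine hsum.congr_fun fun p => ?_
  rw [torusCoeff, ← integral_const_mul]
  refine integral_congr_ae (Eventually.of_forall fun w => ?_)
  simp only [hF, neg_sub]
  ring

/-- Since `f` has no negative frequencies, only the pairs `(α, α + γ)` contribute to the double
series. -/
theorem integral_mul_norm_szego_sq {f : Torus → ℂ} {C : ℝ}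
    (hf : AEStronglyMeasurable f torusMeasure) (hC : ∀ᵐ w ∂torusMeasure, ‖f w‖ ≤ C)
    (hneg : ∀ α : ℕ →₀ ℤ, (¬ ∀ i, 0 ≤ α i) → torusCoeff f α = 0)
    (hz : Summable fun α => ‖monomial z α‖) :
    ∫ w, f w * ((‖szego z w‖ ^ 2 : ℝ) : ℂ) ∂torusMeasure =
      (∑' α, starRingEnd ℂ (monomial z α) * monomial z α) *
        ∑' γ, torusCoeff f (toIntIndex γ) * monomial z γ := by
  have hdiag : Summable fun α => ‖starRingEnd ℂ (monomial z α) * monomial z α‖ := by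
    simpa only [norm_mul, RCLike.norm_conj, pow_two] using summable_norm_monomial_sq hz
  have hcoeff : Summable fun γ => ‖torusCoeff f (toIntIndex γ) * monomial z γ‖ := by
    refine Summable.of_nonneg_of_le (fun _ => norm_nonneg _) (fun γ => ?_) (hz.mul_left C)
    rw [norm_mul]
    gcongr
    exact norm_torusCoeff_le hC _
  have hprod := hasSum_mul_of_summable_norm hdiag hcoeff
  set shear : (ℕ →₀ ℕ) × (ℕ →₀ ℕ) → (ℕ →₀ ℕ) × (ℕ →₀ ℕ) := fun p => (p.1, p.1 + p.2) with hshear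
  have hinj : Function.Injective shear := by
    rintro ⟨α, γ⟩ ⟨α', γ'⟩ h
    obtain ⟨rfl, h⟩ := Prod.mk.inj h
    exact Prod.ext rfl (add_left_cancel h)
  refine (hasSum_integral_mul_norm_szego_sq (Integrable.of_bound hf C hC) hz).unique
    ((hinj.hasSum_iff ?_).1 (hprod.congr_fun fun p => ?_))
  · rintro ⟨α, β⟩ hp
    rw [hneg _ fun h => hp ⟨(α, β - α), Prod.ext rfl (add_tsub_cancel_of_le fun i => ?_)⟩, mul_zero]
    exact Int.ofNat_le.1 (sub_nonneg.1 (h i))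
  · simp only [hshear, Function.comp_apply, monomial_add, toIntIndex_add, add_sub_cancel_left]
    ring

theorem tsum_conj_monomial_mul_monomial (z : ℕ → ℂ) :
    ∑' α, starRingEnd ℂ (monomial z α) * monomial z α = ((∑' α, ‖monomial z α‖ ^ 2 : ℝ) : ℂ) := by
  simp only [Complex.ofReal_tsum, mul_comm (starRingEnd ℂ _), Complex.mul_conj,
    Complex.normSq_eq_norm_sq]

theorem integral_norm_szego_sq (hz : Summable fun α => ‖monomial z α‖) :
    ∫ w, ‖szego z w‖ ^ 2 ∂torusMeasure = ∑' α, ‖monomial z α‖ ^ 2 := by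
  have h := integral_mul_norm_szego_sq (f := torusMonomial 0) (C := 1)
    (continuous_torusMonomial 0).aestronglyMeasurable
    (Eventually.of_forall fun w => (norm_torusMonomial 0 w).le)
    (fun α hα => by
      rw [torusCoeff_torusMonomial, if_neg]
      rintro rfl
      exact hα fun _ => le_rfl) hz
  have hone : ∑' γ, torusCoeff (torusMonomial 0) (toIntIndex γ) * monomial z γ = 1 := by
    rw [tsum_eq_single 0 fun γ hγ => ?_]
    · rw [torusCoeff_torusMonomial, toIntIndex_zero, if_pos rfl, monomial_zero, one_mul]
    · rw [torusCoeff_torusMonomial, if_neg, zero_mul]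
      exact fun h => hγ (toIntIndex_injective (h.symm.trans toIntIndex_zero.symm))
  rw [hone, mul_one, tsum_conj_monomial_mul_monomial] at h
  simp only [torusMonomial_zero, one_mul, integral_complex_ofReal] at h
  exact_mod_cast h

/-- Integrating against the Poisson kernel, the normalized square of the Szegő kernel. -/
theorem norm_tsum_hardyCoeff_le (f : HInfTorus) (hz : Summable fun α => ‖monomial z α‖) :
    ‖∑' α, hardyCoeff f α * monomial z α‖ ≤ ‖f‖ := by
  have hpos : 0 < ∑' α, ‖monomial z α‖ ^ 2 :=
    (summable_norm_monomial_sq hz).tsum_pos (fun _ => by positivity) 0 (by simp [monomial_zero])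
  have hint : Integrable (fun w => ‖szego z w‖ ^ 2) torusMeasure :=
    not_imp_comm.1 integral_undef (integral_norm_szego_sq hz ▸ hpos.ne')
  have hle : ‖∫ w, (f : LInfTorus) w * ((‖szego z w‖ ^ 2 : ℝ) : ℂ) ∂torusMeasure‖ ≤
      ‖f‖ * ∑' α, ‖monomial z α‖ ^ 2 := by
    rw [← integral_norm_szego_sq hz, ← integral_const_mul]
    refine norm_integral_le_of_norm_le (hint.const_mul _) ?_
    filter_upwards [LInfTorus.ae_norm_le f] with w hw
    rw [norm_mul, Complex.norm_of_nonneg (by positivity)]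
    gcongr
    exact hw
  rw [integral_mul_norm_szego_sq (Lp.aestronglyMeasurable _) (LInfTorus.ae_norm_le f) f.2 hz,
    tsum_conj_monomial_mul_monomial, norm_mul, Complex.norm_of_nonneg hpos.le, mul_comm] at hle
  exact le_of_mul_le_mul_right hle hpos

theorem differentiableOn_tsum_monomial_trunc {c : (ℕ →₀ ℕ) → ℂ} {M : ℝ} (hc : ∀ α, ‖c α‖ ≤ M)
    (n : ℕ) :
    DifferentiableOn ℂ (fun x : CZero => ∑' α, c α * monomial (trunc n x) α)
      (Metric.ball 0 1) := by
  have hM : 0 ≤ M := (norm_nonneg _).trans (hc 0)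
  intro x hx
  obtain ⟨r, hxr, hr1⟩ := exists_between (mem_ball_zero_iff.1 hx)
  have hr0 : 0 ≤ r := (norm_nonneg _).trans hxr.le
  set ρ : ℕ → ℝ := fun i => if i < n then r else 0 with hρ
  have hsum : Summable (monomial ρ) := by
    refine summable_monomial (n := n) (fun i => ?_) (fun i => ?_) fun i hi => if_neg hi.not_gt
    all_goals simp only [hρ]; split_ifs <;> linarith
  have hle (y : CZero) (hy : y ∈ Metric.ball 0 r) (i : ℕ) : ‖trunc n y i‖ ≤ ρ i := by
    rw [trunc_apply, hρ]
    beta_reduce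
    split_ifs
    · exact (y.norm_apply_le i).trans (mem_ball_zero_iff.1 hy).le
    · exact norm_zero.le
  have hdiff : DifferentiableOn ℂ (fun x : CZero => ∑' α, c α * monomial (trunc n x) α)
      (Metric.ball 0 r) := by
    refine differentiableOn_tsum_of_norm_le Metric.isOpen_ball
      (fun α => ((differentiable_monomial_trunc n α).const_mul _).differentiableOn)
      (hsum.mul_left M) fun α y hy => ?_
    rw [norm_mul]
    exact mul_le_mul (hc α) (norm_monomial_le (hle y hy) α) (norm_nonneg _) hM
  exact (hdiff.differentiableAt
    (Metric.isOpen_ball.mem_nhds (mem_ball_zero_iff.2 hxr))).differentiableWithinAt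

/-- The element of `H_∞(𝔻₀^∞)` given by a function on `c₀` that is differentiable and bounded on the
unit ball. -/
def HInfBall.ofDifferentiableOn (G : CZero → ℂ) (hG : DifferentiableOn ℂ G (Metric.ball 0 1))
    (M : ℝ) (hM : ∀ x ∈ Metric.ball (0 : CZero) 1, ‖G x‖ ≤ M) : HInfBall :=
  ⟨BoundedContinuousFunction.ofNormedAddCommGroup (fun x : CZeroBall => G x)
    (continuousOn_iff_continuous_domRestrict.1 hG.continuousOn) M fun x => hM x x.2,
    ⟨G, hG, fun _ => rfl⟩⟩

theorem HInfBall.norm_ofDifferentiableOn_le {G : CZero → ℂ}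
    (hG : DifferentiableOn ℂ G (Metric.ball 0 1)) {M : ℝ}
    (hM : ∀ x ∈ Metric.ball (0 : CZero) 1, ‖G x‖ ≤ M) :
    ‖HInfBall.ofDifferentiableOn G hG M hM‖ ≤ M :=
  BoundedContinuousFunction.norm_ofNormedAddCommGroup_le _
    ((norm_nonneg _).trans (hM 0 (Metric.mem_ball_self one_pos))) fun x : CZeroBall => hM x x.2

theorem exists_holomorphic_of_hardy (f : HInfTorus) :
    ∃ g : HInfBall, ‖g‖ ≤ ‖f‖ ∧ IsMonomialCoeff g (hardyCoeff f) := by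
  obtain ⟨G, hG, hGM, hGlim⟩ := exists_differentiableOn_of_norm_le
    (f := fun n (x : CZero) => ∑' α, hardyCoeff f α * monomial (trunc n x) α)
    (U := Metric.ball (0 : CZero) 1) (M := ‖f‖) Metric.isOpen_ball
    (fun n => differentiableOn_tsum_monomial_trunc (norm_hardyCoeff_le f) n)
    fun n x hx => norm_tsum_hardyCoeff_le f
      (summable_norm_monomial_trunc (mem_ball_zero_iff.1 hx) n)
  refine ⟨HInfBall.ofDifferentiableOn G hG _ hGM, HInfBall.norm_ofDifferentiableOn_le hG hGM,
    fun k z hz => ?_⟩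
  have htrunc (n : ℕ) (hn : k ≤ n) : trunc n (z : CZero) = z :=
    trunc_eq_self fun i hi => hz i (hn.trans hi)
  have hsum : Summable fun α => hardyCoeff f α * monomial (z : CZero) α := by
    have hz1 := summable_norm_monomial_trunc (mem_ball_zero_iff.1 z.2) k
    rw [htrunc k le_rfl] at hz1
    refine Summable.of_norm_bounded (hz1.mul_left ‖f‖) fun α => ?_
    rw [norm_mul]
    gcongr
    exact norm_hardyCoeff_le f α
  have hval : G z = ∑' α, hardyCoeff f α * monomial (z : CZero) α := by
    refine hGlim z z.2 _ (tendsto_const_nhds.congr' ?_)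
    filter_upwards [eventually_ge_atTop k] with n hn
    rw [htrunc n hn]
  exact (hval ▸ hsum.hasSum : HasSum _ (G z))

end Poisson

section Expansion

theorem norm_trunc_add_smul_unitVec_lt {x : CZero} {ζ : ℂ} (hx : ‖x‖ < 1) (hζ : ‖ζ‖ < 1) (n : ℕ) :
    ‖trunc n x + ζ • unitVec n‖ < 1 := by
  refine (CZero.norm_le (le_max_of_le_left (norm_nonneg x)) fun i => ?_).trans_lt (max_lt hx hζ)
  change ‖trunc n x i + ζ * unitVec n i‖ ≤ _
  rw [trunc_apply, unitVec_apply]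
  rcases lt_trichotomy i n with h | rfl | h
  · simpa [h, h.ne] using Or.inl (x.norm_apply_le i)
  · simp
  · simp [h.not_gt, h.ne']

theorem trunc_add_smul_unitVec {n : ℕ} {x : CZero} (h : ∀ i, n + 1 ≤ i → x i = 0) :
    trunc n x + x n • unitVec n = x := by
  conv_rhs => rw [← trunc_eq_self h, trunc_eq_sum, Finset.sum_range_succ, ← trunc_eq_sum]

/-- The `k`-th Taylor coefficient at `0` of `F` in the `n`-th variable, as a function of the
variables of index less than `n` (the variables of larger index are set to `0`). -/
def taylorCoeff (F : CZero → ℂ) (n k : ℕ) (x : CZero) : ℂ :=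
  (k.factorial : ℂ)⁻¹ * iteratedDeriv k (fun ζ : ℂ => F (trunc n x + ζ • unitVec n)) 0

section TaylorCoeff

variable {F : CZero → ℂ} (hF : DifferentiableOn ℂ F (Metric.ball 0 1))
include hF

theorem differentiableOn_comp_trunc_add_smul_unitVec {x : CZero} (hx : x ∈ Metric.ball 0 1)
    (n : ℕ) :
    DifferentiableOn ℂ (fun ζ : ℂ => F (trunc n x + ζ • unitVec n)) (Metric.ball 0 1) :=
  hF.comp (by fun_prop) fun _ hζ => mem_ball_zero_iff.2
    (norm_trunc_add_smul_unitVec_lt (mem_ball_zero_iff.1 hx) (mem_ball_zero_iff.1 hζ) n)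

theorem hasSum_taylorCoeff {x : CZero} (hx : x ∈ Metric.ball 0 1) (n : ℕ) {ζ : ℂ}
    (hζ : ζ ∈ Metric.ball 0 1) :
    HasSum (fun k => taylorCoeff F n k x * ζ ^ k) (F (trunc n x + ζ • unitVec n)) := by
  refine (Complex.hasSum_taylorSeries_on_ball
    (differentiableOn_comp_trunc_add_smul_unitVec hF hx n) hζ).congr_fun fun k => ?_
  simp only [taylorCoeff, sub_zero, smul_eq_mul]
  ring

theorem norm_taylorCoeff_le {M : ℝ} (hM : ∀ x ∈ Metric.ball (0 : CZero) 1, ‖F x‖ ≤ M) {x : CZero}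
    (hx : x ∈ Metric.ball 0 1) (n k : ℕ) : ‖taylorCoeff F n k x‖ ≤ M := by
  have h := norm_iteratedDeriv_le_of_norm_le_ball one_pos
    (differentiableOn_comp_trunc_add_smul_unitVec hF hx n)
    (fun ζ hζ => hM _ (mem_ball_zero_iff.2 (norm_trunc_add_smul_unitVec_lt
      (mem_ball_zero_iff.1 hx) (mem_ball_zero_iff.1 hζ) n))) k
  rw [one_pow, div_one] at h
  rw [taylorCoeff, norm_mul, norm_inv, Complex.norm_natCast]
  exact inv_mul_le_of_le_mul₀ (by positivity) ((norm_nonneg _).trans (hM x hx)) h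

theorem differentiableOn_taylorCoeff (n k : ℕ) :
    DifferentiableOn ℂ (taylorCoeff F n k) (Metric.ball 0 1) :=
  ((differentiableOn_iteratedDeriv_comp_line Metric.isOpen_ball hF (unitVec n) k).comp
    (truncL n).differentiable.differentiableOn fun x hx => mem_ball_zero_iff.2
      ((norm_trunc_coe_le n x).trans_lt (mem_ball_zero_iff.1 hx))).const_mul _

end TaylorCoeff

theorem monomial_trunc_erase_mul_pow {n : ℕ} {z : CZero} (hz : ∀ i, n + 1 ≤ i → z i = 0)
    (α : ℕ →₀ ℕ) : monomial (trunc n z) (α.erase n) * z n ^ α n = monomial z α := by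
  have h : monomial (trunc n z) (α.erase n) = monomial z (α.erase n) := by
    refine monomial_congr fun i hi => ?_
    have hin : i ≠ n := by rintro rfl; exact hi Finsupp.erase_same
    rw [trunc_apply]
    split_ifs with hlt
    · rfl
    · exact (hz i (by omega)).symm
  rw [h, ← monomial_single, ← monomial_add, Finsupp.erase_add_single]

theorem hasSum_erase_monomial {c : ℕ → (ℕ →₀ ℕ) → ℂ} {M : ℝ} {n : ℕ} {z : CZero} {a : ℕ → ℂ} {s : ℂ}
    (hc : ∀ k β, ‖c k β‖ ≤ M) (hc0 : ∀ k β, β n ≠ 0 → c k β = 0) (hz1 : ‖z‖ < 1)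
    (hz : ∀ i, n + 1 ≤ i → z i = 0)
    (ha : ∀ k, HasSum (fun β => c k β * monomial (trunc n z) β) (a k))
    (hs : HasSum (fun k => a k * z n ^ k) s) :
    HasSum (fun α => c (α n) (α.erase n) * monomial z α) s := by
  set f : ℕ × (ℕ →₀ ℕ) → ℂ := fun p => c p.1 p.2 * monomial (trunc n z) p.2 * z n ^ p.1
  have hf : Summable f := by
    have h := (summable_geometric_of_lt_one (norm_nonneg (z n))
      ((z.norm_apply_le n).trans_lt hz1)).mul_of_nonneg (summable_norm_monomial_trunc hz1 n)
      (fun _ => by positivity) fun _ => norm_nonneg _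
    refine Summable.of_norm_bounded (h.mul_left M) fun p => ?_
    rw [norm_mul, norm_mul, norm_pow, mul_comm (‖z n‖ ^ _), ← mul_assoc]
    gcongr
    exact hc _ _
  have hfs : HasSum f s := by
    rw [hs.unique (hf.hasSum.prod_fiberwise fun k => (ha k).mul_right (z n ^ k))]
    exact hf.hasSum
  set split : (ℕ →₀ ℕ) → ℕ × (ℕ →₀ ℕ) := fun α => (α n, α.erase n)
  have hinj : Function.Injective split := fun α β h => by
    obtain ⟨h1, h2⟩ := Prod.mk.inj h
    rw [← Finsupp.erase_add_single n α, ← Finsupp.erase_add_single n β, h1, h2]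
  have hrange (p) (hp : p ∉ range split) : f p = 0 := by
    obtain ⟨k, β⟩ := p
    have hβ : β n ≠ 0 := fun hβ => hp ⟨β + Finsupp.single n k, by
      simp [split, hβ, Finsupp.erase_add, Finsupp.erase_of_notMem_support]⟩
    simp only [f, hc0 k β hβ, zero_mul]
  refine ((hinj.hasSum_iff hrange).2 hfs).congr_fun fun α => ?_
  rw [← monomial_trunc_erase_mul_pow hz, ← mul_assoc]
  rfl

theorem exists_monomial_expansion {M : ℝ} (n : ℕ) {F : CZero → ℂ}
    (hF : DifferentiableOn ℂ F (Metric.ball 0 1))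
    (hM : ∀ x ∈ Metric.ball (0 : CZero) 1, ‖F x‖ ≤ M) :
    ∃ c : (ℕ →₀ ℕ) → ℂ, (∀ α, ‖c α‖ ≤ M) ∧ (∀ α i, n ≤ i → α i ≠ 0 → c α = 0) ∧
      ∀ z ∈ Metric.ball (0 : CZero) 1, (∀ i, n ≤ i → z i = 0) →
        HasSum (fun α => c α * monomial z α) (F z) := by
  induction n generalizing F with
  | zero =>
    have h0 := hM 0 (Metric.mem_ball_self one_pos)
    refine ⟨Pi.single 0 (F 0), fun α => ?_, fun α i _ hi => ?_, fun z _ hz => ?_⟩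
    · rw [Pi.single_apply]
      split_ifs
      · exact h0
      · exact norm_zero.trans_le ((norm_nonneg _).trans h0)
    · exact Pi.single_eq_of_ne (by rintro rfl; exact hi rfl) _
    · obtain rfl : z = 0 := by ext i; exact hz i (Nat.zero_le i)
      convert hasSum_single (0 : ℕ →₀ ℕ) fun α hα => ?_ using 1
      · rw [Pi.single_eq_same, monomial_zero, mul_one]
      · rw [Pi.single_eq_of_ne hα, zero_mul]
  | succ n ih =>
    choose c hcM hc0 hcs using fun k =>
      ih (differentiableOn_taylorCoeff hF n k) fun x hx => norm_taylorCoeff_le hF hM hx n k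
    refine ⟨fun α => c (α n) (α.erase n), fun α => hcM _ _, fun α i hi hαi => ?_,
      fun z hz hz0 => ?_⟩
    · exact hc0 _ _ i (by omega) (by rwa [Finsupp.erase_ne (by omega)])
    · have hz1 := mem_ball_zero_iff.1 hz
      have htz := mem_ball_zero_iff.2 ((norm_trunc_coe_le n z).trans_lt hz1)
      have htz0 (i : ℕ) (hi : n ≤ i) : trunc n z i = 0 := trunc_apply_of_le hi _
      refine hasSum_erase_monomial hcM (fun k β hβ => hc0 k β n le_rfl hβ) hz1 hz0
        (fun k => hcs k _ htz htz0) ?_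
      have h := hasSum_taylorCoeff hF htz n
        (mem_ball_zero_iff.2 ((z.norm_apply_le n).trans_lt hz1))
      rwa [trunc_eq_self htz0, trunc_add_smul_unitVec hz0] at h

end Expansion

section WeakCompactness

theorem exists_tendsto_inner_ultrafilter {ι H : Type*} [NormedAddCommGroup H]
    [InnerProductSpace ℂ H] [CompleteSpace H] {x : ι → H} {C : ℝ} (hx : ∀ j, ‖x j‖ ≤ C)
    (u : Ultrafilter ι) :
    ∃ v : H, ∀ h : H, Tendsto (fun j => inner ℂ h (x j)) u (𝓝 (inner ℂ h v)) := by
  set φ : ι → WeakDual ℂ H := fun j => StrongDual.toWeakDual (InnerProductSpace.toDual ℂ H (x j))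
  have hφ (j : ι) : φ j ∈ WeakDual.toStrongDual ⁻¹' Metric.closedBall (0 : StrongDual ℂ H) C :=
    mem_closedBall_zero_iff.2 (((InnerProductSpace.toDual ℂ H).norm_map (x j)).trans_le (hx j))
  obtain ⟨ψ, -, hψ⟩ := (WeakDual.isCompact_closedBall (𝕜 := ℂ) (0 : StrongDual ℂ H)
    C).ultrafilter_le_nhds (u.map φ) (tendsto_principal.2 (Eventually.of_forall hφ))
  refine ⟨(InnerProductSpace.toDual ℂ H).symm (WeakDual.toStrongDual ψ), fun h => ?_⟩
  have hlim : Tendsto (fun j => inner ℂ (x j) h) u (𝓝 (ψ h)) :=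
    ((WeakDual.eval_continuous h).tendsto ψ).comp hψ
  have hstar := (Complex.continuous_conj.tendsto _).comp hlim
  rw [← inner_conj_symm, InnerProductSpace.toDual_symm_apply]
  exact hstar.congr fun j => inner_conj_symm _ _

variable {Ω ι : Type*} [MeasurableSpace Ω] {μ : Measure Ω} [IsFiniteMeasure μ]

theorem ae_norm_le_of_forall_norm_integral_mul_le {g : Ω → ℂ} {M : ℝ} (hM : 0 ≤ M)
    (hg : Integrable g μ) (h : ∀ k : Ω → ℂ, AEStronglyMeasurable k μ → (∀ w, ‖k w‖ ≤ 1) →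
      ‖∫ w, g w * k w ∂μ‖ ≤ M * ∫ w, ‖k w‖ ∂μ) :
    ∀ᵐ w ∂μ, ‖g w‖ ≤ M := by
  refine ae_le_of_forall_setIntegral_le hg.norm (integrable_const M) fun s hs _ => ?_
  -- Test against the conjugate phase of `g` on `s`; it vanishes where `g` does, since `0 / 0 = 0`.
  set k : Ω → ℂ := s.indicator fun w => starRingEnd ℂ (g w) / ‖g w‖ with hk
  have hk_norm (w : Ω) : ‖k w‖ ≤ s.indicator 1 w := by
    rw [hk, norm_indicator_eq_indicator_norm]
    refine indicator_le_indicator ?_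
    rw [norm_div, RCLike.norm_conj, Complex.norm_real, norm_norm]
    exact div_self_le_one _
  have hk_meas : AEStronglyMeasurable k μ :=
    ((Complex.continuous_conj.comp_aestronglyMeasurable hg.1).div₀
      (Complex.continuous_ofReal.comp_aestronglyMeasurable hg.1.norm)).indicator hs
  have hgk (w : Ω) : g w * k w = ((s.indicator (fun w => ‖g w‖) w : ℝ) : ℂ) := by
    by_cases hw : w ∈ s
    · rw [hk, indicator_of_mem hw, indicator_of_mem hw, mul_div_assoc', Complex.mul_conj,
        Complex.normSq_eq_norm_sq, ← Complex.ofReal_div, sq, mul_self_div_self]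
    · rw [hk, indicator_of_notMem hw, indicator_of_notMem hw, mul_zero, Complex.ofReal_zero]
  have hle := h k hk_meas fun w => (hk_norm w).trans (indicator_le_self' (by simp) w)
  simp only [hgk] at hle
  rw [integral_complex_ofReal, integral_indicator hs, Complex.norm_real,
    Real.norm_of_nonneg (integral_nonneg fun _ => norm_nonneg _)] at hle
  calc ∫ w in s, ‖g w‖ ∂μ ≤ M * ∫ w, ‖k w‖ ∂μ := hle
    _ ≤ M * ∫ w, s.indicator 1 w ∂μ := by
        gcongr
        · exact (Integrable.of_bound hk_meas 1 (Eventually.of_forall fun w =>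
            (hk_norm w).trans (indicator_le_self' (by simp) w))).norm
        · exact (integrable_const 1).indicator hs
        · exact hk_norm
    _ = ∫ _ in s, M ∂μ := by
        rw [integral_indicator_one hs, setIntegral_const, smul_eq_mul, mul_comm]

theorem exists_tendsto_integral_mul_ultrafilter {f : ι → Ω → ℂ} {M : ℝ} (hM : 0 ≤ M)
    (hf : ∀ j, AEStronglyMeasurable (f j) μ) (hfM : ∀ j w, ‖f j w‖ ≤ M) (u : Ultrafilter ι) :
    ∃ g : Ω → ℂ, MemLp g ∞ μ ∧ (∀ᵐ w ∂μ, ‖g w‖ ≤ M) ∧ ∀ k : Ω → ℂ, MemLp k 2 μ →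
      Tendsto (fun j => ∫ w, f j w * k w ∂μ) u (𝓝 (∫ w, g w * k w ∂μ)) := by
  have hf2 (j : ι) : MemLp (f j) 2 μ := MemLp.of_bound (hf j) M (Eventually.of_forall (hfM j))
  have hbound (j : ι) : ‖(hf2 j).toLp‖ ≤ measureUnivNNReal μ ^ (2 : ℝ≥0∞).toReal⁻¹ * M :=
    Lp.norm_le_of_ae_bound hM ((hf2 j).coeFn_toLp.mono fun w hw => hw ▸ hfM j w)
  obtain ⟨v, hv⟩ := exists_tendsto_inner_ultrafilter hbound u
  have hinner (k : Ω → ℂ) (hk : MemLp (star k) 2 μ) (f : Lp ℂ 2 μ) :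
      inner ℂ hk.toLp f = ∫ w, f w * k w ∂μ := by
    rw [L2.inner_def]
    refine integral_congr_ae ?_
    filter_upwards [hk.coeFn_toLp] with w hw
    simp only [hw, RCLike.inner_apply, Pi.star_apply, RCLike.star_def, Complex.conj_conj]
  have hlim (k : Ω → ℂ) (hk : MemLp k 2 μ) :
      Tendsto (fun j => ∫ w, f j w * k w ∂μ) u (𝓝 (∫ w, v w * k w ∂μ)) := by
    have h := hv (hk.star.toLp)
    rw [hinner] at h
    refine h.congr fun j => ?_
    rw [hinner]
    refine integral_congr_ae ?_
    filter_upwards [(hf2 j).coeFn_toLp] with w hw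
    rw [hw]
  have hvM : ∀ᵐ w ∂μ, ‖v w‖ ≤ M := by
    refine ae_norm_le_of_forall_norm_integral_mul_le hM ((Lp.memLp v).integrable one_le_two)
      fun k hk hk1 => ?_
    refine le_of_tendsto (hlim k (MemLp.of_bound hk 1 (Eventually.of_forall hk1))).norm
      (Eventually.of_forall fun j => ?_)
    rw [← integral_const_mul]
    refine norm_integral_le_of_norm_le ?_ (Eventually.of_forall fun w => ?_)
    · exact ((Integrable.of_bound hk 1 (Eventually.of_forall hk1)).norm.const_mul M)
    · rw [norm_mul]
      gcongr
      exact hfM j w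
  exact ⟨v, memLp_top_of_bound (Lp.aestronglyMeasurable v) M hvM, hvM, hlim⟩

end WeakCompactness

section Boundary

theorem exists_lInfTorus_of_norm_le {f : ℕ → Torus → ℂ} {M : ℝ}
    (hf : ∀ j, AEStronglyMeasurable (f j) torusMeasure) (hfM : ∀ j w, ‖f j w‖ ≤ M) :
    ∃ g : LInfTorus, ‖g‖ ≤ M ∧
      ∀ β a, Tendsto (fun j => torusCoeff (f j) β) atTop (𝓝 a) → fourierCoeff g β = a := by
  have hM : 0 ≤ M := (norm_nonneg _).trans (hfM 0 1)
  obtain ⟨g, hg, hgM, hlim⟩ :=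
    exists_tendsto_integral_mul_ultrafilter hM hf hfM (Ultrafilter.of atTop)
  refine ⟨hg.toLp g, LInfTorus.norm_le hM (hg.coeFn_toLp.mp (hgM.mono fun w hw h => h ▸ hw)),
    fun β a ha => ?_⟩
  have hmonomial : MemLp (torusMonomial (-β)) 2 torusMeasure :=
    MemLp.of_bound (measurable_torusMonomial _).aestronglyMeasurable 1
      (Eventually.of_forall fun w => (norm_torusMonomial _ w).le)
  exact (torusCoeff_congr_ae hg.coeFn_toLp β).trans
    (tendsto_nhds_unique (hlim _ hmonomial) (ha.mono_left (Ultrafilter.of_le atTop)))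

theorem hasSum_torusCoeff {b : (ℕ →₀ ℕ) → ℂ} {f : Torus → ℂ} (hb : Summable fun α => ‖b α‖)
    (hf : ∀ w, HasSum (fun α => b α * torusMonomial (toIntIndex α) w) (f w)) (β : ℕ →₀ ℤ) :
    HasSum (fun α => if toIntIndex α = β then b α else 0) (torusCoeff f β) := by
  have hterm (α : ℕ →₀ ℕ) (w : Torus) : b α * torusMonomial (toIntIndex α) w *
      torusMonomial (-β) w = b α * torusMonomial (toIntIndex α - β) w := by
    rw [mul_assoc, ← torusMonomial_add, sub_eq_add_neg]
  have hnorm (α : ℕ →₀ ℕ) (w : Torus) : ‖b α * torusMonomial (toIntIndex α - β) w‖ = ‖b α‖ := by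
    rw [norm_mul, norm_torusMonomial, mul_one]
  have h := hasSum_integral_of_summable_integral_norm (μ := torusMeasure)
    (F := fun (α : ℕ →₀ ℕ) w => b α * torusMonomial (toIntIndex α - β) w)
    (fun α => Integrable.of_bound
      ((measurable_torusMonomial _).aestronglyMeasurable.const_mul _) ‖b α‖
      (Eventually.of_forall fun w => (hnorm α w).le))
    (by simpa only [hnorm, integral_const, probReal_univ, one_smul] using hb)
  have htsum (w : Torus) :
      ∑' α, b α * torusMonomial (toIntIndex α - β) w = f w * torusMonomial (-β) w := by
    simp only [← hterm]
    exact ((hf w).mul_right _).tsum_eq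
  simp only [htsum] at h
  refine h.congr_fun fun α => ?_
  simp only [integral_const_mul, integral_torusMonomial, sub_eq_zero, mul_ite, mul_one, mul_zero]

theorem torusCoeff_toIntIndex_of_hasSum {b : (ℕ →₀ ℕ) → ℂ} {f : Torus → ℂ}
    (hb : Summable fun α => ‖b α‖)
    (hf : ∀ w, HasSum (fun α => b α * torusMonomial (toIntIndex α) w) (f w)) (α : ℕ →₀ ℕ) :
    torusCoeff f (toIntIndex α) = b α := by
  have h := hasSum_torusCoeff hb hf (toIntIndex α)
  simp only [toIntIndex_injective.eq_iff] at h
  exact h.unique ((hasSum_ite_eq α (b α)).congr_fun fun γ =>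
    ite_congr rfl (congr_arg b) fun _ => rfl)

theorem torusCoeff_eq_zero_of_hasSum {b : (ℕ →₀ ℕ) → ℂ} {f : Torus → ℂ}
    (hb : Summable fun α => ‖b α‖)
    (hf : ∀ w, HasSum (fun α => b α * torusMonomial (toIntIndex α) w) (f w)) {β : ℕ →₀ ℤ}
    (hβ : ¬ ∀ i, 0 ≤ β i) : torusCoeff f β = 0 := by
  have hne (α : ℕ →₀ ℕ) : toIntIndex α ≠ β := by
    rintro rfl
    exact hβ fun i => Int.natCast_nonneg (α i)
  have h := hasSum_torusCoeff hb hf β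
  simp only [hne, if_false] at h
  exact h.unique hasSum_zero

/-- The point `(r w_0, …, r w_{n-1}, 0, …)` of `c₀`. -/
def dilate (n : ℕ) (r : ℝ) (w : Torus) : CZero := trunc n fun i => (r : ℂ) * (w i : ℂ)

theorem dilate_mem_ball {n : ℕ} {r : ℝ} (h0 : 0 ≤ r) (h1 : r < 1) (w : Torus) :
    dilate n r w ∈ Metric.ball (0 : CZero) 1 := by
  refine mem_ball_zero_iff.2 ((norm_trunc_le h0 fun i _ => ?_).trans_lt h1)
  rw [norm_mul, Circle.norm_coe, mul_one, Complex.norm_real, Real.norm_of_nonneg h0]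

theorem continuous_dilate (n : ℕ) (r : ℝ) : Continuous (dilate n r) := by
  have h : dilate n r = fun w => ∑ i ∈ Finset.range n, ((r : ℂ) * (w i : ℂ)) • unitVec i :=
    funext fun w => trunc_eq_sum _ _
  rw [h]
  fun_prop

theorem monomial_dilate (n : ℕ) (r : ℝ) (w : Torus) (α : ℕ →₀ ℕ) :
    monomial (dilate n r w) α =
      monomial (trunc n fun _ => (r : ℂ)) α * torusMonomial (toIntIndex α) w := by
  classical
  rw [torusMonomial_toIntIndex, dilate, monomial_trunc, monomial_trunc, monomial_mul]
  split_ifs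
  · rfl
  · rw [zero_mul]

/-- `F` has the monomial expansion with coefficients `c` in the first `n` variables. -/
def HasExpansion (F : CZero → ℂ) (n : ℕ) (c : (ℕ →₀ ℕ) → ℂ) : Prop :=
  ∀ z ∈ Metric.ball (0 : CZero) 1, (∀ i, n ≤ i → z i = 0) →
    HasSum (fun α => c α * monomial z α) (F z)

namespace HasExpansion

variable {F : CZero → ℂ} {n : ℕ} {c : (ℕ →₀ ℕ) → ℂ} (h : HasExpansion F n c) {r : ℝ} (h0 : 0 ≤ r)
  (h1 : r < 1)
include h

theorem mono {m : ℕ} (hmn : m ≤ n) : HasExpansion F m c :=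
  fun z hz hz0 => h z hz fun i hi => hz0 i (hmn.trans hi)

include h0 h1

theorem hasSum_dilate (w : Torus) :
    HasSum (fun α => c α * monomial (trunc n fun _ => (r : ℂ)) α * torusMonomial (toIntIndex α) w)
      (F (dilate n r w)) := by
  have hw := h _ (dilate_mem_ball h0 h1 w) fun i hi => trunc_apply_of_le hi _
  simpa only [monomial_dilate, mul_assoc] using hw

theorem summable_norm_dilate :
    Summable fun α => ‖c α * monomial (trunc n fun _ => (r : ℂ)) α‖ := by
  have hw := (h.hasSum_dilate h0 h1 1).summable.norm
  simpa only [norm_mul, norm_torusMonomial, mul_one] using hw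

theorem torusCoeff_dilate (α : ℕ →₀ ℕ) : torusCoeff (fun w => F (dilate n r w)) (toIntIndex α) =
    c α * monomial (trunc n fun _ => (r : ℂ)) α :=
  torusCoeff_toIntIndex_of_hasSum (h.summable_norm_dilate h0 h1) (h.hasSum_dilate h0 h1) α

theorem torusCoeff_dilate_eq_zero {β : ℕ →₀ ℤ} (hβ : ¬ ∀ i, 0 ≤ β i) :
    torusCoeff (fun w => F (dilate n r w)) β = 0 :=
  torusCoeff_eq_zero_of_hasSum (h.summable_norm_dilate h0 h1) (h.hasSum_dilate h0 h1) hβ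

omit h0 h1

theorem coeff_unique {c' : (ℕ →₀ ℕ) → ℂ} (h' : HasExpansion F n c') {α : ℕ →₀ ℕ}
    (hα : ∀ i, n ≤ i → α i = 0) : c α = c' α := by
  have heq := h.torusCoeff_dilate (r := 1 / 2) (by norm_num) (by norm_num) α
  rw [h'.torusCoeff_dilate (by norm_num) (by norm_num), monomial_trunc, if_pos hα,
    monomial_const] at heq
  exact (mul_right_cancel₀ (pow_ne_zero _ (by norm_num)) heq).symm

end HasExpansion

theorem exists_support_bound (α : ℕ →₀ ℕ) : ∃ n, ∀ i, n ≤ i → α i = 0 := by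
  obtain ⟨n, hn⟩ := Finset.exists_nat_subset_range α.support
  exact ⟨n, fun i hi => Finsupp.notMem_support_iff.1 fun h =>
    hi.not_gt (Finset.mem_range.1 (hn h))⟩

theorem isMonomialCoeff_iff {g : HInfBall} {G : CZero → ℂ}
    (hG : ∀ x : CZeroBall, G x = (g : CZeroBall →ᵇ ℂ) x) {c : (ℕ →₀ ℕ) → ℂ} :
    IsMonomialCoeff g c ↔ ∀ n, HasExpansion G n c := by
  refine forall_congr' fun n => ⟨fun h z hz hz0 => ?_, fun h z hz0 => ?_⟩
  · rw [hG ⟨z, hz⟩]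
    exact h ⟨z, hz⟩ hz0
  · rw [← hG]
    exact h z z.2 hz0

theorem IsMonomialCoeff.unique {g : HInfBall} {c c' : (ℕ →₀ ℕ) → ℂ} (h : IsMonomialCoeff g c)
    (h' : IsMonomialCoeff g c') : c = c' := by
  obtain ⟨G, -, hG⟩ := g.2
  funext α
  obtain ⟨n, hn⟩ := exists_support_bound α
  exact ((isMonomialCoeff_iff hG).1 h n).coeff_unique ((isMonomialCoeff_iff hG).1 h' n) hn

theorem HInfBall.exists_extension (g : HInfBall) :
    ∃ G : CZero → ℂ, DifferentiableOn ℂ G (Metric.ball 0 1) ∧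
      (∀ x : CZeroBall, G x = (g : CZeroBall →ᵇ ℂ) x) ∧ ∀ x ∈ Metric.ball (0 : CZero) 1,
        ‖G x‖ ≤ ‖g‖ := by
  obtain ⟨G, hGd, hG⟩ := g.2
  refine ⟨G, hGd, hG, fun x hx => ?_⟩
  rw [hG ⟨x, hx⟩]
  exact (g : CZeroBall →ᵇ ℂ).norm_coe_le_norm _

theorem exists_isMonomialCoeff (g : HInfBall) : ∃ c, IsMonomialCoeff g c := by
  obtain ⟨G, hGd, hG, hGM⟩ := HInfBall.exists_extension g
  choose c _ _ hc using fun n => exists_monomial_expansion n hGd hGM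
  choose N hN using exists_support_bound
  refine ⟨fun α => c (N α) α, (isMonomialCoeff_iff hG).2 fun n z hz hz0 => ?_⟩
  refine (hc n z hz hz0).congr_fun fun α => ?_
  by_cases hα : ∀ i, n ≤ i → α i = 0
  · have hn : HasExpansion G (min n (N α)) (c n) := HasExpansion.mono (hc n) (min_le_left _ _)
    have hN' : HasExpansion G (min n (N α)) (c (N α)) :=
      HasExpansion.mono (hc (N α)) (min_le_right _ _)
    rw [hN'.coeff_unique hn fun i hi => (min_le_iff.1 hi).elim (hα i) (hN α i)]
  · push Not at hα
    obtain ⟨i, hi, hαi⟩ := hα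
    rw [monomial_eq_zero hαi (hz0 i hi), mul_zero, mul_zero]

theorem tendsto_monomial_trunc_const {r : ℕ → ℝ} (hr : Tendsto r atTop (𝓝 1)) (α : ℕ →₀ ℕ) :
    Tendsto (fun j => monomial (trunc j fun _ => (r j : ℂ)) α) atTop (𝓝 1) := by
  obtain ⟨n, hn⟩ := exists_support_bound α
  have hpow : Tendsto (fun j => (r j : ℂ) ^ α.degree) atTop (𝓝 1) := by
    simpa using ((Complex.continuous_ofReal.tendsto 1).comp hr).pow α.degree
  refine hpow.congr' ?_
  filter_upwards [eventually_ge_atTop n] with j hj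
  rw [monomial_trunc, if_pos fun i hi => hn i (hj.trans hi), monomial_const]

theorem exists_hardy_of_holomorphic (g : HInfBall) :
    ∃ f : HInfTorus, ‖f‖ ≤ ‖g‖ ∧ IsMonomialCoeff g (hardyCoeff f) := by
  obtain ⟨c, hc⟩ := exists_isMonomialCoeff g
  obtain ⟨G, hGd, hG, hGM⟩ := HInfBall.exists_extension g
  have hexp := (isMonomialCoeff_iff hG).1 hc
  obtain ⟨r, -, hr, hrlim⟩ := exists_seq_strictMono_tendsto' (zero_lt_one (α := ℝ))
  have hmem (j : ℕ) (w : Torus) : dilate j (r j) w ∈ Metric.ball (0 : CZero) 1 :=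
    dilate_mem_ball (hr j).1.le (hr j).2 w
  obtain ⟨f, hfM, hf⟩ := exists_lInfTorus_of_norm_le (f := fun j w => G (dilate j (r j) w))
    (fun j => (hGd.continuousOn.comp_continuous (continuous_dilate j (r j))
      (hmem j)).aestronglyMeasurable)
    (fun j w => hGM _ (hmem j w))
  refine ⟨⟨f, fun β hβ => hf β 0 ?_⟩, hfM, ?_⟩
  · simp only [(hexp _).torusCoeff_dilate_eq_zero (hr _).1.le (hr _).2 hβ, tendsto_const_nhds]
  · convert hc
    funext α
    refine hf (toIntIndex α) (c α) ?_
    simp only [(hexp _).torusCoeff_dilate (hr _).1.le (hr _).2 α]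
    simpa only [mul_one] using (tendsto_monomial_trunc_const hrlim α).const_mul (c α)

theorem IsMonomialCoeff.add {g h : HInfBall} {c d : (ℕ →₀ ℕ) → ℂ} (hg : IsMonomialCoeff g c)
    (hh : IsMonomialCoeff h d) : IsMonomialCoeff (g + h) (c + d) := fun k z hz =>
  ((hg k z hz).add (hh k z hz)).congr_fun fun _ => add_mul _ _ _

theorem IsMonomialCoeff.smul {g : HInfBall} {c : (ℕ →₀ ℕ) → ℂ} (hg : IsMonomialCoeff g c) (a : ℂ) :
    IsMonomialCoeff (a • g) (a • c) := fun k z hz =>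
  ((hg k z hz).mul_left a).congr_fun fun _ => mul_assoc _ _ _

theorem exists_linearIsometryEquiv :
    ∃ φ : HInfTorus ≃ₗᵢ[ℂ] HInfBall, ∀ f, IsMonomialCoeff (φ f) (hardyCoeff f) := by
  choose Φ hΦ hΦc using exists_holomorphic_of_hardy
  have hadd (f g : HInfTorus) : Φ (f + g) = Φ f + Φ g := by
    refine (hΦc (f + g)).eq ?_
    convert (hΦc f).add (hΦc g)
    exact funext fun α => fourierCoeff_add _ _ _
  have hsmul (a : ℂ) (f : HInfTorus) : Φ (a • f) = a • Φ f := by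
    refine (hΦc (a • f)).eq ?_
    convert (hΦc f).smul a
    exact funext fun α => fourierCoeff_smul _ _ _
  have hinv (g : HInfBall) : ∃ f, ‖f‖ ≤ ‖g‖ ∧ Φ f = g := by
    obtain ⟨f, hf, hfc⟩ := exists_hardy_of_holomorphic g
    exact ⟨f, hf, (hΦc f).eq hfc⟩
  have hinj : Function.Injective Φ := fun f g h =>
    HInfTorus.ext_hardyCoeff fun α => congr_fun ((h ▸ hΦc f).unique (hΦc g)) α
  have hnorm (f : HInfTorus) : ‖Φ f‖ = ‖f‖ := by
    refine le_antisymm (hΦ f) ?_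
    obtain ⟨f', hf', h⟩ := hinv (Φ f)
    rwa [hinj h] at hf'
  let L : HInfTorus →ₗᵢ[ℂ] HInfBall :=
    ⟨{ toFun := Φ, map_add' := hadd, map_smul' := hsmul }, hnorm⟩
  exact ⟨LinearIsometryEquiv.ofSurjective L fun g => (hinv g).imp fun _ h => h.2, hΦc⟩

end Boundary

section Arens

theorem sum_norm_unitVec_le (φ : CZero →L[ℂ] ℂ) (n : ℕ) :
    ∑ i ∈ Finset.range n, ‖φ (unitVec i)‖ ≤ ‖φ‖ := by
  choose s hs hsφ using fun i => Complex.exists_norm_eq_mul_self (φ (unitVec i))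
  have hφ : φ (trunc n s) = ((∑ i ∈ Finset.range n, ‖φ (unitVec i)‖ : ℝ) : ℂ) := by
    simp only [trunc_eq_sum, map_sum, map_smul, smul_eq_mul, Complex.ofReal_sum, hsφ]
  have hle := φ.le_opNorm_of_le (norm_trunc_le (n := n) zero_le_one fun i _ => (hs i).le)
  rwa [hφ, Complex.norm_of_nonneg (Finset.sum_nonneg fun _ _ => norm_nonneg _), mul_one] at hle

theorem summable_norm_unitVec (φ : CZero →L[ℂ] ℂ) : Summable fun i => ‖φ (unitVec i)‖ :=
  summable_of_sum_range_le (fun _ => norm_nonneg _) (sum_norm_unitVec_le φ)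

theorem tsum_norm_unitVec_le (φ : CZero →L[ℂ] ℂ) : ∑' i, ‖φ (unitVec i)‖ ≤ ‖φ‖ :=
  Real.tsum_le_of_sum_range_le (fun _ => norm_nonneg _) (sum_norm_unitVec_le φ)

/-- The element of `ℓ₁` representing a functional on `c₀`. -/
def dualSeq (φ : CZero →L[ℂ] ℂ) : EllOne :=
  ⟨fun i => φ (unitVec i), (memℓp_gen_iff (p := 1) (by norm_num)).2
    (by simpa using summable_norm_unitVec φ)⟩

theorem EllInf.norm_apply_le (y : EllInf) (i : ℕ) : ‖y i‖ ≤ ‖y‖ :=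
  lp.norm_apply_le_norm ENNReal.top_ne_zero y i

theorem norm_mul_unitVec_le (φ : CZero →L[ℂ] ℂ) (y : EllInf) (i : ℕ) :
    ‖y i * φ (unitVec i)‖ ≤ ‖y‖ * ‖φ (unitVec i)‖ := by
  rw [norm_mul]
  gcongr
  exact y.norm_apply_le i

theorem summable_mul_unitVec (φ : CZero →L[ℂ] ℂ) (y : EllInf) :
    Summable fun i => y i * φ (unitVec i) :=
  .of_norm_bounded ((summable_norm_unitVec φ).mul_left ‖y‖) (norm_mul_unitVec_le φ y)

/-- The canonical embedding `c₀' = ℓ₁ → ℓ_∞'`. -/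
def extendFunctional : (CZero →L[ℂ] ℂ) →L[ℂ] (EllInf →L[ℂ] ℂ) :=
  LinearMap.mkContinuous₂
    (LinearMap.mk₂ ℂ (fun (φ : CZero →L[ℂ] ℂ) y => ∑' i, (y : EllInf) i * φ (unitVec i))
      (fun φ ψ y => by
        rw [← (summable_mul_unitVec φ y).tsum_add (summable_mul_unitVec ψ y)]
        exact tsum_congr fun i => mul_add _ _ _)
      (fun c φ y => by
        rw [smul_eq_mul, ← tsum_mul_left]
        exact tsum_congr fun i => mul_left_comm _ _ _)
      (fun φ y y' => by
        rw [← (summable_mul_unitVec φ y).tsum_add (summable_mul_unitVec φ y')]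
        exact tsum_congr fun i => add_mul _ _ _)
      (fun c φ y => by
        rw [smul_eq_mul, ← tsum_mul_left]
        exact tsum_congr fun i => mul_assoc _ _ _)) 1
    fun φ y => by
      rw [one_mul, mul_comm]
      refine (tsum_of_norm_bounded ((summable_norm_unitVec φ).hasSum.mul_left ‖y‖)
        (norm_mul_unitVec_le φ y)).trans ?_
      gcongr
      exact tsum_norm_unitVec_le φ

theorem hasSum_extendFunctional (φ : CZero →L[ℂ] ℂ) (y : EllInf) :
    HasSum (fun i => y i * φ (unitVec i)) (extendFunctional φ y) :=
  (summable_mul_unitVec φ y).hasSum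

theorem sum_mul_unitVec (φ : CZero →L[ℂ] ℂ) (u : ℕ → ℂ) (n : ℕ) :
    ∑ i ∈ Finset.range n, u i * φ (unitVec i) = φ (trunc n u) := by
  simp only [trunc_eq_sum, map_sum, map_smul, smul_eq_mul]

theorem extendFunctional_toEllInf (φ : CZero →L[ℂ] ℂ) (x : CZero) :
    extendFunctional φ x.toEllInf = φ x :=
  tendsto_nhds_unique (hasSum_extendFunctional φ x.toEllInf).tendsto_sum_nat
    (((φ.continuous.tendsto x).comp (tendsto_trunc x)).congr fun n => (sum_mul_unitVec φ x n).symm)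

theorem continuous_extendFunctional (φ : CZero →L[ℂ] ℂ) :
    @Continuous EllInf ℂ weakStarTopology inferInstance (extendFunctional φ) :=
  @Continuous.comp EllInf (EllOne → ℂ) ℂ weakStarTopology _ _ _ _
    (continuous_apply (dualSeq φ)) continuous_induced_dom

/-- Bounded `m`-linear forms on `c₀`. -/
abbrev CZeroForm (m : ℕ) : Type := ContinuousMultilinearMap ℂ (fun _ : Fin m => CZero) ℂ

/-- Bounded `m`-linear forms on `ℓ_∞`. -/
abbrev EllInfForm (m : ℕ) : Type := ContinuousMultilinearMap ℂ (fun _ : Fin m => EllInf) ℂ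

/-- The extension of multilinear forms, one variable after the other (the last variable first),
that is induced by an extension operator `J` for functionals. -/
def extendForms {E F : Type*} [NormedAddCommGroup E] [NormedSpace ℂ E]
    [NormedAddCommGroup F] [NormedSpace ℂ F] (J : (E →L[ℂ] ℂ) →L[ℂ] (F →L[ℂ] ℂ)) : (m : ℕ) →
      ContinuousMultilinearMap ℂ (fun _ : Fin m => E) ℂ →L[ℂ]
        ContinuousMultilinearMap ℂ (fun _ : Fin m => F) ℂ
  | 0 =>
    ((continuousMultilinearCurryFin0 ℂ F ℂ).symm.toContinuousLinearEquiv : ℂ →L[ℂ] _) ∘L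
      ((continuousMultilinearCurryFin0 ℂ E ℂ).toContinuousLinearEquiv : _ →L[ℂ] ℂ)
  | m + 1 =>
    ((continuousMultilinearCurryLeftEquiv ℂ (fun _ : Fin (m + 1) => F)
        ℂ).symm.toContinuousLinearEquiv :
          (F →L[ℂ] ContinuousMultilinearMap ℂ (fun _ : Fin m => F) ℂ) →L[ℂ] _) ∘L
      ((ContinuousLinearMap.flipMultilinearEquiv ℂ (fun _ : Fin m => F) F ℂ).symm :
        _ →L[ℂ] (F →L[ℂ] ContinuousMultilinearMap ℂ (fun _ : Fin m => F) ℂ)) ∘L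
      (ContinuousLinearMap.compContinuousMultilinearMapL ℂ (fun _ : Fin m => F)
        (E →L[ℂ] ℂ) (F →L[ℂ] ℂ) J) ∘L
      ((ContinuousLinearMap.flipMultilinearEquiv ℂ (fun _ : Fin m => F) E ℂ) :
        (E →L[ℂ] ContinuousMultilinearMap ℂ (fun _ : Fin m => F) ℂ) →L[ℂ] _) ∘L
      (ContinuousLinearMap.compL ℂ E _ _ (extendForms J m)) ∘L
      ((continuousMultilinearCurryLeftEquiv ℂ (fun _ : Fin (m + 1) => E)
        ℂ).toContinuousLinearEquiv :
          _ →L[ℂ] (E →L[ℂ] ContinuousMultilinearMap ℂ (fun _ : Fin m => E) ℂ))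

/-- The Arens extension `A ↦ Ã` of bounded `m`-linear forms from `c₀` to `ℓ_∞`. -/
def arens (m : ℕ) : CZeroForm m →L[ℂ] EllInfForm m := extendForms extendFunctional m

/-- The functional `x ↦ Ã(x, v_1, …, v_m)` on `c₀`. -/
def arensSlice {m : ℕ} (A : CZeroForm (m + 1)) (v : Fin m → EllInf) : CZero →L[ℂ] ℂ :=
  (ContinuousMultilinearMap.apply ℂ (fun _ : Fin m => EllInf) ℂ v) ∘L (arens m) ∘L A.curryLeft

theorem arensSlice_apply {m : ℕ} (A : CZeroForm (m + 1)) (v : Fin m → EllInf) (x : CZero) :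
    arensSlice A v x = arens m (A.curryLeft x) v := rfl

theorem arens_zero_apply (A : CZeroForm 0) (z : Fin 0 → EllInf) : arens 0 A z = A 0 := rfl

theorem arens_succ_apply {m : ℕ} (A : CZeroForm (m + 1)) (z : Fin (m + 1) → EllInf) :
    arens (m + 1) A z = extendFunctional (arensSlice A fun i => z i.succ) (z 0) := rfl

theorem isArensExtension_arens {m : ℕ} (A : CZeroForm m) : IsArensExtension A (arens m A) := by
  induction m with
  | zero =>
    refine ⟨fun x => ?_, fun j => j.elim0⟩
    rw [arens_zero_apply, Subsingleton.elim x 0]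
  | succ m ih =>
    refine ⟨fun x => ?_, fun j x z => ?_⟩
    · rw [arens_succ_apply, extendFunctional_toEllInf, arensSlice_apply, (ih _).extends_form,
        ContinuousMultilinearMap.curryLeft_apply]
      exact congr_arg A (Fin.cons_self_tail x)
    · simp only [arens_succ_apply]
      cases j using Fin.cases with
      | zero =>
        simp only [Fin.not_lt_zero, if_false, if_true, Fin.succ_ne_zero]
        exact continuous_extendFunctional _
      | succ j =>
        simp only [Fin.succ_pos, if_true, extendFunctional_toEllInf, arensSlice_apply,
          Fin.succ_lt_succ_iff, Fin.succ_inj]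
        exact (ih (A.curryLeft (x 0))).weakStar_continuous j (fun i => x i.succ) fun i => z i.succ

end Arens

section AronBerner

theorem exists_norm_extendForms_apply_le {E F : Type*} [NormedAddCommGroup E] [NormedSpace ℂ E]
    [NormedAddCommGroup F] [NormedSpace ℂ F] (J : (E →L[ℂ] ℂ) →L[ℂ] (F →L[ℂ] ℂ)) (m : ℕ) :
    ∃ C : ℝ, 0 ≤ C ∧ ∀ (A : ContinuousMultilinearMap ℂ (fun _ : Fin m => E) ℂ) (v : Fin m → F),
      (∀ i, ‖v i‖ ≤ 1) → ‖extendForms J m A v‖ ≤ C * ‖A‖ := by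
  obtain ⟨C, hC0, hC⟩ := (extendForms J m).bound
  refine ⟨C, hC0.le, fun A v hv => ((extendForms J m A).le_opNorm _).trans ?_⟩
  refine (mul_le_of_le_one_right (norm_nonneg _) ?_).trans (hC A)
  exact Finset.prod_le_one (fun _ _ => norm_nonneg _) fun i _ => hv i

/-- For the symmetric form `A` of a polynomial `P`, this is `AB(P)` on `𝕋^∞`. -/
def arensDiag {m : ℕ} (A : CZeroForm m) (w : Torus) : ℂ := arens m A fun _ => w.toEllInf

theorem Torus.norm_toEllInf_le (w : Torus) : ‖w.toEllInf‖ ≤ 1 :=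
  lp.norm_le_of_forall_le zero_le_one fun i => (Circle.norm_coe (w i)).le

theorem exists_norm_arensDiag_le (m : ℕ) :
    ∃ C : ℝ, 0 ≤ C ∧ ∀ (A : CZeroForm m) (w : Torus), ‖arensDiag A w‖ ≤ C * ‖A‖ := by
  obtain ⟨C, hC0, hC⟩ := exists_norm_extendForms_apply_le extendFunctional m
  exact ⟨C, hC0, fun A w => hC A _ fun _ => w.norm_toEllInf_le⟩

theorem norm_curryLeft_apply_le {E : Type*} [NormedAddCommGroup E] [NormedSpace ℂ E] {m : ℕ}
    (A : ContinuousMultilinearMap ℂ (fun _ : Fin (m + 1) => E) ℂ) {x : E} (hx : ‖x‖ ≤ 1) :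
    ‖A.curryLeft x‖ ≤ ‖A‖ := by
  refine (A.curryLeft.le_opNorm_of_le hx).trans_eq ?_
  rw [mul_one, ContinuousMultilinearMap.curryLeft_norm]

theorem hasSum_arensDiag {m : ℕ} (A : CZeroForm (m + 1)) (w : Torus) :
    HasSum (fun i => (w i : ℂ) * arensDiag (A.curryLeft (unitVec i)) w) (arensDiag A w) :=
  hasSum_extendFunctional (arensSlice A fun _ => w.toEllInf) w.toEllInf

theorem exists_norm_sum_arensDiag_le {m : ℕ} (A : CZeroForm (m + 1)) :
    ∃ C : ℝ, ∀ (w : Torus) (n : ℕ),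
      ‖∑ i ∈ Finset.range n, (w i : ℂ) * arensDiag (A.curryLeft (unitVec i)) w‖ ≤ C := by
  obtain ⟨C, hC0, hC⟩ := exists_norm_arensDiag_le m
  refine ⟨C * ‖A‖, fun w n => ?_⟩
  have hsum : ∑ i ∈ Finset.range n, (w i : ℂ) * arensDiag (A.curryLeft (unitVec i)) w =
      arensDiag (A.curryLeft (trunc n fun i => (w i : ℂ))) w :=
    sum_mul_unitVec (arensSlice A fun _ => w.toEllInf) (fun i => (w i : ℂ)) n
  rw [hsum]
  refine (hC _ w).trans (mul_le_mul_of_nonneg_left ?_ hC0)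
  exact norm_curryLeft_apply_le A
    (norm_trunc_le zero_le_one fun i _ => (Circle.norm_coe (w i)).le)

theorem measurable_torus_coe (i : ℕ) : Measurable fun w : Torus => (w i : ℂ) :=
  (continuous_subtype_val.comp (continuous_apply i)).measurable

theorem measurable_arensDiag {m : ℕ} (A : CZeroForm m) : Measurable (arensDiag A) := by
  induction m with
  | zero => exact measurable_const
  | succ m ih =>
    exact measurable_of_tendsto_metrizable
      (f := fun n w => ∑ i ∈ Finset.range n, (w i : ℂ) * arensDiag (A.curryLeft (unitVec i)) w)
      (fun n => Finset.measurable_fun_sum _ fun i _ => (measurable_torus_coe i).mul (ih _))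
      (tendsto_pi_nhds.2 fun w => (hasSum_arensDiag A w).tendsto_sum_nat)

theorem memLp_arensDiag {m : ℕ} (A : CZeroForm m) : MemLp (arensDiag A) ∞ torusMeasure := by
  obtain ⟨C, -, hC⟩ := exists_norm_arensDiag_le m
  exact memLp_top_of_bound (measurable_arensDiag A).aestronglyMeasurable _
    (Eventually.of_forall (hC A))

theorem integrable_arensDiag {m : ℕ} (A : CZeroForm m) : Integrable (arensDiag A) torusMeasure :=
  (memLp_arensDiag A).integrable le_top

theorem tendsto_torusCoeff_arensDiag {m : ℕ} (A : CZeroForm (m + 1)) (α : ℕ →₀ ℤ) :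
    Tendsto (fun n => ∑ i ∈ Finset.range n,
        torusCoeff (arensDiag (A.curryLeft (unitVec i))) (α - Finsupp.single i 1))
      atTop (𝓝 (torusCoeff (arensDiag A) α)) := by
  have hterm (i : ℕ) (w : Torus) :
      (w i : ℂ) * arensDiag (A.curryLeft (unitVec i)) w * torusMonomial (-α) w =
        arensDiag (A.curryLeft (unitVec i)) w * torusMonomial (-(α - Finsupp.single i 1)) w := by
    rw [neg_sub, sub_eq_add_neg, torusMonomial_add, torusMonomial_single, zpow_one]
    ring
  obtain ⟨C, hC⟩ := exists_norm_sum_arensDiag_le A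
  have h := tendsto_integral_of_dominated_convergence (μ := torusMeasure)
    (F := fun n w => (∑ i ∈ Finset.range n, (w i : ℂ) * arensDiag (A.curryLeft (unitVec i)) w) *
      torusMonomial (-α) w) (f := fun w => arensDiag A w * torusMonomial (-α) w)
    (fun _ => C)
    (fun n => ((Finset.measurable_fun_sum _ fun i _ => (measurable_torus_coe i).mul
      (measurable_arensDiag _)).mul (measurable_torusMonomial _)).aestronglyMeasurable)
    (integrable_const _)
    (fun n => Eventually.of_forall fun w => by
      rw [norm_mul, norm_torusMonomial, mul_one]
      exact hC w n)
    (Eventually.of_forall fun w => (hasSum_arensDiag A w).tendsto_sum_nat.mul_const _)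
  refine h.congr fun n => ?_
  simp_rw [Finset.sum_mul, hterm]
  exact integral_finsetSum _ fun i _ => integrable_mul_torusMonomial' (integrable_arensDiag _) _

theorem torusCoeff_arensDiag_zero (A : CZeroForm 0) (α : ℕ →₀ ℤ) :
    torusCoeff (arensDiag A) α = if 0 = α then A 0 else 0 := by
  have h : arensDiag A = fun w => A 0 * torusMonomial 0 w := by
    funext w
    rw [torusMonomial_zero, mul_one]
    exact arens_zero_apply A _
  rw [h, torusCoeff_const_mul, torusCoeff_torusMonomial, mul_ite, mul_one, mul_zero]

theorem torusCoeff_arensDiag_eq_zero_of_neg {m : ℕ} (A : CZeroForm m) {α : ℕ →₀ ℤ} {j : ℕ}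
    (hj : α j < 0) : torusCoeff (arensDiag A) α = 0 := by
  induction m generalizing α with
  | zero =>
    rw [torusCoeff_arensDiag_zero, if_neg]
    rintro rfl
    exact hj.ne rfl
  | succ m ih =>
    have hterm (i : ℕ) :
        torusCoeff (arensDiag (A.curryLeft (unitVec i))) (α - Finsupp.single i 1) = 0 := by
      refine ih _ ?_
      rw [Finsupp.sub_apply, Finsupp.single_apply]
      split_ifs <;> omega
    refine tendsto_nhds_unique (tendsto_torusCoeff_arensDiag A α) ?_
    simp only [hterm, Finset.sum_const_zero, tendsto_const_nhds]

theorem torusCoeff_arensDiag_sub_single {m : ℕ} (A : CZeroForm m) {α : ℕ →₀ ℕ} {i : ℕ}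
    (hi : α i = 0) : torusCoeff (arensDiag A) (toIntIndex α - Finsupp.single i 1) = 0 := by
  refine torusCoeff_arensDiag_eq_zero_of_neg (j := i) A ?_
  rw [Finsupp.sub_apply, toIntIndex_apply, Finsupp.single_eq_same, hi]
  norm_num

theorem torusCoeff_arensDiag_succ {m : ℕ} (A : CZeroForm (m + 1)) {α : ℕ →₀ ℕ} {n : ℕ}
    (hα : ∀ i, n ≤ i → α i = 0) :
    torusCoeff (arensDiag A) (toIntIndex α) = ∑ i ∈ Finset.range n,
      torusCoeff (arensDiag (A.curryLeft (unitVec i))) (toIntIndex α - Finsupp.single i 1) := by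
  refine tendsto_nhds_unique (tendsto_torusCoeff_arensDiag A _) (tendsto_const_nhds.congr' ?_)
  filter_upwards [eventually_ge_atTop n] with k hk
  exact Finset.sum_subset (Finset.range_subset_range.2 hk) fun i _ hi =>
    torusCoeff_arensDiag_sub_single _ (hα i (by simpa using hi))

theorem sub_single_add_single {α : ℕ →₀ ℕ} {i : ℕ} (hi : α i ≠ 0) :
    α - Finsupp.single i 1 + Finsupp.single i 1 = α :=
  tsub_add_cancel_of_le (Finsupp.single_le_iff.2 (Nat.one_le_iff_ne_zero.2 hi))

theorem toIntIndex_add_single_sub (α : ℕ →₀ ℕ) (i : ℕ) :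
    toIntIndex (α + Finsupp.single i 1) - Finsupp.single i 1 = toIntIndex α := by
  rw [toIntIndex_add, toIntIndex_single, Nat.cast_one, add_sub_cancel_right]

theorem torusCoeff_arensDiag_eq_zero_of_degree {m : ℕ} (A : CZeroForm m) {α : ℕ →₀ ℕ}
    (hα : α.degree ≠ m) : torusCoeff (arensDiag A) (toIntIndex α) = 0 := by
  induction m generalizing α with
  | zero =>
    rw [torusCoeff_arensDiag_zero, if_neg]
    rw [← toIntIndex_zero, toIntIndex_injective.eq_iff]
    rintro rfl
    exact hα (map_zero _)
  | succ m ih =>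
    obtain ⟨n, hn⟩ := exists_support_bound α
    rw [torusCoeff_arensDiag_succ A hn]
    refine Finset.sum_eq_zero fun i _ => ?_
    by_cases hi : α i = 0
    · exact torusCoeff_arensDiag_sub_single _ hi
    · rw [← sub_single_add_single hi, toIntIndex_add_single_sub]
      refine ih _ fun h => hα ?_
      rw [← sub_single_add_single hi, map_add, h, Finsupp.degree_single]

theorem apply_diag_eq_sum {m : ℕ} (A : CZeroForm (m + 1)) {n : ℕ} {z : CZero}
    (hz : ∀ i, n ≤ i → z i = 0) :
    (A fun _ => z) = ∑ i ∈ Finset.range n, z i * A.curryLeft (unitVec i) fun _ => z := by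
  have hcurry : (A fun _ => z) = A.curryLeft z fun _ => z := by
    rw [ContinuousMultilinearMap.curryLeft_apply]
    exact congr_arg A (Fin.cons_self_tail (fun _ : Fin (m + 1) => z)).symm
  have hexpand : A.curryLeft z = ∑ i ∈ Finset.range n, z i • A.curryLeft (unitVec i) := by
    conv_lhs => rw [← trunc_eq_self hz, trunc_eq_sum]
    rw [map_sum]
    simp only [map_smul]
  rw [hcurry, hexpand, sum_apply]
  rfl

theorem hasSum_mul_monomial_shift {c : (ℕ →₀ ℤ) → ℂ} {i : ℕ}
    (hc : ∀ α : ℕ →₀ ℕ, α i = 0 → c (toIntIndex α - Finsupp.single i 1) = 0) {z : ℕ → ℂ} {s : ℂ}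
    (h : HasSum (fun α => c (toIntIndex α) * monomial z α) s) :
    HasSum (fun α => c (toIntIndex α - Finsupp.single i 1) * monomial z α) (z i * s) := by
  have hinj : Function.Injective fun β : ℕ →₀ ℕ => β + Finsupp.single i 1 := add_left_injective _
  refine (hinj.hasSum_iff fun α hα => ?_).1 ((h.mul_left (z i)).congr_fun fun β => ?_)
  · rw [hc, zero_mul]
    by_contra hi
    exact hα ⟨_, sub_single_add_single hi⟩
  · rw [Function.comp_apply, toIntIndex_add_single_sub, monomial_add, monomial_single, pow_one]
    ring

theorem hasSum_torusCoeff_arensDiag {m : ℕ} (A : CZeroForm m) {n : ℕ} {z : CZero}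
    (hz : ∀ i, n ≤ i → z i = 0) :
    HasSum (fun α => torusCoeff (arensDiag A) (toIntIndex α) * monomial z α) (A fun _ => z) := by
  classical
  induction m with
  | zero =>
    rw [Subsingleton.elim (fun _ : Fin 0 => z) 0]
    refine (hasSum_ite_eq (0 : ℕ →₀ ℕ) (A 0)).congr_fun fun α => ?_
    by_cases h : α = 0
    · rw [if_pos h, h, toIntIndex_zero, torusCoeff_arensDiag_zero, if_pos rfl, monomial_zero,
        mul_one]
    · rw [if_neg h, torusCoeff_arensDiag_eq_zero_of_degree A
        (by rwa [Ne, Finsupp.degree_eq_zero_iff]), zero_mul]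
  | succ m ih =>
    have hterm (i : ℕ) := hasSum_mul_monomial_shift (i := i)
      (fun α => torusCoeff_arensDiag_sub_single (A.curryLeft (unitVec i)))
      (ih (A.curryLeft (unitVec i)))
    rw [apply_diag_eq_sum A hz]
    refine (hasSum_sum fun i _ => hterm i).congr_fun fun α => ?_
    rw [← Finset.sum_mul]
    by_cases hα : ∀ i, n ≤ i → α i = 0
    · rw [torusCoeff_arensDiag_succ A hα]
    · push Not at hα
      obtain ⟨i, hi, hαi⟩ := hα
      rw [monomial_eq_zero hαi (hz i hi), mul_zero, mul_zero]

theorem fourierCoeff_toLp_arensDiag {m : ℕ} (A : CZeroForm m) (α : ℕ →₀ ℤ) :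
    fourierCoeff (memLp_arensDiag A).toLp α = torusCoeff (arensDiag A) α :=
  torusCoeff_congr_ae (memLp_arensDiag A).coeFn_toLp α

/-- The class of `arensDiag A` in `H_∞(𝕋^∞)`. -/
def arensHardy {m : ℕ} (A : CZeroForm m) : HInfTorus :=
  ⟨(memLp_arensDiag A).toLp, fun α hα => by
    push Not at hα
    obtain ⟨j, hj⟩ := hα
    rw [fourierCoeff_toLp_arensDiag, torusCoeff_arensDiag_eq_zero_of_neg A hj]⟩

theorem hardyCoeff_arensHardy {m : ℕ} (A : CZeroForm m) (α : ℕ →₀ ℕ) :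
    hardyCoeff (arensHardy A) α = torusCoeff (arensDiag A) (toIntIndex α) :=
  fourierCoeff_toLp_arensDiag A _

theorem arensHardy_mem {m : ℕ} (A : CZeroForm m) : arensHardy A ∈ HInfTorusHom m := fun α hα => by
  by_contra h
  exact hα (by rw [hardyCoeff_arensHardy, torusCoeff_arensDiag_eq_zero_of_degree A h])

theorem coeFn_arensHardy {m : ℕ} (A : CZeroForm m) :
    ((arensHardy A : LInfTorus) : Torus → ℂ) =ᵐ[torusMeasure] arensDiag A :=
  (memLp_arensDiag A).coeFn_toLp

theorem isMonomialCoeff_arensHardy {m : ℕ} {A : CZeroForm m} {P : HomPoly m}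
    (hA : ∀ x, (P : CZero → ℂ) x = A fun _ => x) :
    IsMonomialCoeff (HomPoly.toHInfBall P) (hardyCoeff (arensHardy A)) := fun n z hz => by
  have hPz : ((HomPoly.toHInfBall P : HInfBall) : CZeroBall →ᵇ ℂ) z = A fun _ => (z : CZero) :=
    hA z
  rw [hPz]
  exact (hasSum_torusCoeff_arensDiag A hz).congr_fun fun α => by
    rw [hardyCoeff_arensHardy, monomial]

end AronBerner

section Polarization

theorem sum_neg_one_pow_card_filter_forall_notMem {ι : Type*} [Fintype ι] [DecidableEq ι]
    (r : ι → ι) :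
    ∑ T : Finset ι with ∀ i, r i ∉ T, (-1 : ℤ) ^ T.card =
      if Function.Bijective r then 1 else 0 := by
  have hpowerset : ({T : Finset ι | ∀ i, r i ∉ T} : Finset (Finset ι)) =
      ((Finset.univ.image r)ᶜ).powerset := by
    ext T
    simp [Finset.subset_compl_iff_disjoint_right, Finset.disjoint_right]
  have hempty : (Finset.univ.image r)ᶜ = ∅ ↔ Function.Bijective r := by
    rw [Finset.compl_eq_empty_iff, ← Finite.surjective_iff_bijective]
    simp [Finset.eq_univ_iff_forall, Function.Surjective]
  rw [hpowerset, Finset.sum_powerset_neg_one_pow_card]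
  simp only [hempty]

theorem polarization {R M N ι : Type*} [CommSemiring R] [AddCommMonoid M] [Module R M]
    [AddCommGroup N] [Module R N] [Fintype ι] [DecidableEq ι]
    (A : MultilinearMap R (fun _ : ι => M) N) (x : ι → M) :
    ∑ σ : Equiv.Perm ι, A (fun i => x (σ i)) =
      ∑ T : Finset ι, (-1 : ℤ) ^ T.card • A fun _ => ∑ i ∈ Tᶜ, x i := by
  have hexpand (T : Finset ι) : (A fun _ => ∑ i ∈ Tᶜ, x i) =
      ∑ r : ι → ι, if ∀ i, r i ∉ T then A (fun i => x (r i)) else 0 := by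
    rw [A.map_sum_finset (fun _ i => x i) fun _ => Tᶜ, ← Finset.sum_filter]
    refine Finset.sum_congr ?_ fun _ _ => rfl
    ext r
    simp
  symm
  calc ∑ T : Finset ι, (-1 : ℤ) ^ T.card • (A fun _ => ∑ i ∈ Tᶜ, x i)
      = ∑ r : ι → ι, (∑ T : Finset ι with ∀ i, r i ∉ T, (-1 : ℤ) ^ T.card) •
          (A fun i => x (r i)) := by
        simp_rw [hexpand, Finset.smul_sum, Finset.sum_smul, Finset.sum_filter, smul_ite, smul_zero]
        exact Finset.sum_comm
    _ = ∑ r : ι → ι with Function.Bijective r, A fun i => x (r i) := by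
        simp_rw [sum_neg_one_pow_card_filter_forall_notMem, ite_smul, one_smul, zero_smul,
          Finset.sum_filter]
    _ = ∑ σ : Equiv.Perm ι, A fun i => x (σ i) := by
        symm
        refine Finset.sum_bij (fun σ _ => ⇑σ) (fun σ _ => ?_)
          (fun σ _ τ _ h => Equiv.coe_fn_injective h) (fun r hr => ?_) fun σ _ => rfl
        · exact Finset.mem_filter.2 ⟨Finset.mem_univ _, σ.bijective⟩
        · exact ⟨Equiv.ofBijective r (Finset.mem_filter.1 hr).2, Finset.mem_univ _, rfl⟩

theorem norm_sum_lt_one_of_norm_lt_inv {E : Type*} [SeminormedAddCommGroup E] {m : ℕ}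
    {x : Fin m → E} (hx : ∀ i, ‖x i‖ < (m + 1 : ℝ)⁻¹) (T : Finset (Fin m)) :
    ‖∑ i ∈ T, x i‖ < 1 := by
  have hm : (0 : ℝ) < m + 1 := by positivity
  have hcard : (T.card : ℝ) ≤ m := by exact_mod_cast card_finset_fin_le T
  calc ‖∑ i ∈ T, x i‖ ≤ T.card • (m + 1 : ℝ)⁻¹ :=
        (norm_sum_le _ _).trans (Finset.sum_le_card_nsmul _ _ _ fun i _ => (hx i).le)
    _ < 1 := by rw [nsmul_eq_mul, ← div_eq_mul_inv, div_lt_one hm]; linarith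

variable {E : Type*} [NormedAddCommGroup E] [NormedSpace ℂ E] {m : ℕ}

/-- The symmetrization of a multilinear form. -/
def symmetrize (A : ContinuousMultilinearMap ℂ (fun _ : Fin m => E) ℂ) :
    ContinuousMultilinearMap ℂ (fun _ : Fin m => E) ℂ :=
  (m.factorial : ℂ)⁻¹ • ∑ σ : Equiv.Perm (Fin m), A.domDomCongr σ

theorem symmetrize_apply (A : ContinuousMultilinearMap ℂ (fun _ : Fin m => E) ℂ) (x : Fin m → E) :
    symmetrize A x = (m.factorial : ℂ)⁻¹ * ∑ σ : Equiv.Perm (Fin m), A fun i => x (σ i) := by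
  simp [symmetrize]

theorem symmetrize_perm (A : ContinuousMultilinearMap ℂ (fun _ : Fin m => E) ℂ)
    (σ : Equiv.Perm (Fin m)) (x : Fin m → E) :
    symmetrize A (fun i => x (σ i)) = symmetrize A x := by
  rw [symmetrize_apply, symmetrize_apply]
  congr 1
  exact Equiv.sum_comp (Equiv.mulLeft σ) fun τ : Equiv.Perm (Fin m) => A fun i => x (τ i)

theorem symmetrize_diag (A : ContinuousMultilinearMap ℂ (fun _ : Fin m => E) ℂ) (x : E) :
    symmetrize A (fun _ => x) = A fun _ => x := by
  rw [symmetrize_apply, Finset.sum_const, Finset.card_univ, Fintype.card_perm, Fintype.card_fin,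
    nsmul_eq_mul, inv_mul_cancel_left₀ (Nat.cast_ne_zero.2 m.factorial_ne_zero)]

theorem norm_symmetrize_apply_le_of_norm_lt_inv
    {A : ContinuousMultilinearMap ℂ (fun _ : Fin m => E) ℂ} {M : ℝ}
    (hM : ∀ y : E, ‖y‖ < 1 → ‖A fun _ => y‖ ≤ M) {x : Fin m → E}
    (hx : ∀ i, ‖x i‖ < (m + 1 : ℝ)⁻¹) : ‖symmetrize A x‖ ≤ 2 ^ m * M := by
  have hsum : ‖∑ σ : Equiv.Perm (Fin m), A fun i => x (σ i)‖ ≤ 2 ^ m * M := by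
    have hpol : ∑ σ : Equiv.Perm (Fin m), (A fun i => x (σ i)) =
        ∑ T : Finset (Fin m), (-1 : ℤ) ^ T.card • A fun _ => ∑ i ∈ Tᶜ, x i :=
      polarization A.toMultilinearMap x
    rw [hpol]
    calc ‖∑ T : Finset (Fin m), (-1 : ℤ) ^ T.card • A fun _ => ∑ i ∈ Tᶜ, x i‖
        ≤ ∑ _T : Finset (Fin m), M := norm_sum_le_of_le _ fun T _ => by
          rw [zsmul_eq_mul, norm_mul, Int.cast_pow, norm_pow, Int.cast_neg, Int.cast_one, norm_neg,
            norm_one, one_pow, one_mul]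
          exact hM _ (norm_sum_lt_one_of_norm_lt_inv hx _)
      _ = 2 ^ m * M := by simp
  have hfact : (m.factorial : ℝ)⁻¹ ≤ 1 :=
    inv_le_one_of_one_le₀ (by exact_mod_cast m.factorial_pos)
  rw [symmetrize_apply, norm_mul, norm_inv, Complex.norm_natCast]
  exact (mul_le_of_le_one_left (norm_nonneg _) hfact).trans hsum

theorem norm_symmetrize_apply_le {A : ContinuousMultilinearMap ℂ (fun _ : Fin m => E) ℂ} {M : ℝ}
    (hM : ∀ y : E, ‖y‖ < 1 → ‖A fun _ => y‖ ≤ M) (x : Fin m → E) :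
    ‖symmetrize A x‖ ≤ 2 ^ m * M * (2 * (m + 1)) ^ m * ∏ i, ‖x i‖ := by
  have hm : (0 : ℝ) < m + 1 := by positivity
  have hM0 : 0 ≤ M := (norm_nonneg _).trans (hM 0 (by simp))
  refine (symmetrize A).toMultilinearMap.bound_of_shell (ε := fun _ => (m + 1 : ℝ)⁻¹)
    (c := fun _ => (2 : ℂ)) (fun _ => inv_pos.2 hm) (fun _ => by simp) (fun y hy hy' => ?_) x
  refine (norm_symmetrize_apply_le_of_norm_lt_inv hM hy').trans ?_
  have hprod : (2 * (m + 1) : ℝ)⁻¹ ^ m ≤ ∏ i, ‖y i‖ := by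
    calc (2 * (m + 1) : ℝ)⁻¹ ^ m = ∏ _i : Fin m, (2 * (m + 1) : ℝ)⁻¹ := by simp
      _ ≤ ∏ i, ‖y i‖ := Finset.prod_le_prod (fun _ _ => by positivity) fun i _ => by
          simpa [mul_inv, div_eq_mul_inv, mul_comm] using hy i
  calc 2 ^ m * M = 2 ^ m * M * (2 * (m + 1)) ^ m * (2 * (m + 1) : ℝ)⁻¹ ^ m := by
        rw [mul_assoc _ (_ ^ m), ← mul_pow, mul_inv_cancel₀ (by positivity), one_pow, mul_one]
    _ ≤ 2 ^ m * M * (2 * (m + 1)) ^ m * ∏ i, ‖y i‖ := by gcongr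

theorem exists_multilinear_limit {A : ℕ → ContinuousMultilinearMap ℂ (fun _ : Fin m => E) ℂ} {C : ℝ}
    (hC : ∀ n x, ‖A n x‖ ≤ C * ∏ i, ‖x i‖) :
    ∃ B : ContinuousMultilinearMap ℂ (fun _ : Fin m => E) ℂ,
      ∀ x a, Tendsto (fun n => A n x) atTop (𝓝 a) → B x = a := by
  choose B hB using fun x => exists_tendsto_ultrafilter_of_norm_le (Ultrafilter.of atTop) (hC · x)
  let B' : MultilinearMap ℂ (fun _ : Fin m => E) ℂ :=
    { toFun := B
      map_update_add' := fun x i y z =>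
        tendsto_nhds_unique (hB _) <| ((hB _).add (hB _)).congr fun n =>
          ((A n).map_update_add _ _ _ _).symm
      map_update_smul' := fun x i c y =>
        tendsto_nhds_unique (hB _) <| ((hB _).const_smul c).congr fun n =>
          ((A n).map_update_smul _ _ _ _).symm }
  refine ⟨B'.mkContinuous C fun x => ?_, fun x a ha => ?_⟩
  · exact le_of_tendsto (hB x).norm (Eventually.of_forall fun n => hC n x)
  · exact tendsto_nhds_unique (hB x) (ha.mono_left (Ultrafilter.of_le _))

end Polarization

section Homogeneous

variable {m : ℕ}

theorem exists_form_monomial (α : ℕ →₀ ℕ) :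
    ∃ A : CZeroForm α.degree, ∀ x : CZero, (A fun _ => x) = monomial x α := by
  set l : List ℕ := (Finsupp.toMultiset α).toList with hl
  have hlen : l.length = α.degree := by
    rw [hl, Multiset.length_toList, Finsupp.card_toMultiset]
    rfl
  rw [← hlen]
  refine ⟨(ContinuousMultilinearMap.mkPiAlgebraFin ℂ l.length ℂ).compContinuousLinearMap
    fun j => coord (l.get j), fun x => ?_⟩
  have hofFn : List.ofFn (fun j => coord (l.get j) x) = l.map x := List.ofFn_getElem_eq_map l x
  rw [ContinuousMultilinearMap.compContinuousLinearMap_apply,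
    ContinuousMultilinearMap.mkPiAlgebraFin_apply, hofFn, hl, ← Multiset.prod_coe,
    ← Multiset.map_coe, Multiset.coe_toList, Finsupp.toMultiset_map, Finsupp.prod_toMultiset,
    Finsupp.prod_mapDomain_index (fun _ => pow_zero _) fun _ _ _ => pow_add _ _ _]
  rfl

theorem trunc_mem_ball {x : CZero} (hx : ‖x‖ < 1) (n : ℕ) :
    trunc n x ∈ Metric.ball (0 : CZero) 1 :=
  mem_ball_zero_iff.2 ((norm_trunc_coe_le n x).trans_lt hx)

theorem HasExpansion.exists_form {G : CZero → ℂ} {n : ℕ} {c : (ℕ →₀ ℕ) → ℂ}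
    (hexp : HasExpansion G n c) (hc : ∀ α, c α ≠ 0 → α.degree = m) :
    ∃ B : CZeroForm m, ∀ x : CZero, ‖x‖ < 1 → (B fun _ => x) = G (trunc n x) := by
  classical
  have hform (α : ℕ →₀ ℕ) :
      ∃ A : CZeroForm m, ∀ x : CZero, c α * (A fun _ => x) = c α * monomial x α := by
    by_cases h : c α = 0
    · exact ⟨0, fun x => by rw [h, zero_mul, zero_mul]⟩
    · obtain ⟨A, hA⟩ := exists_form_monomial α
      rw [← hc α h]
      exact ⟨A, fun x => by rw [hA]⟩
  choose A hA using hform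
  set S := Finset.finsuppAntidiag (Finset.range n) m with hS
  have hmem {α : ℕ →₀ ℕ} (hα : α.degree = m) : α ∈ S ↔ ∀ i, n ≤ i → α i = 0 := by
    rw [hS, Finset.mem_finsuppAntidiag', and_iff_right (show (α.sum fun _ a => a) = m from hα)]
    refine ⟨fun h i hi => Finsupp.notMem_support_iff.1 fun hα =>
      (Finset.mem_range.1 (h hα)).not_ge hi, fun h i hα => Finset.mem_range.2 ?_⟩
    exact not_le.1 fun hi => Finsupp.mem_support_iff.1 hα (h i hi)
  refine ⟨∑ α ∈ S, c α • A α, fun x hx => ?_⟩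
  have hsum : HasSum (fun α => c α * monomial (trunc n x) α) (G (trunc n x)) :=
    hexp _ (trunc_mem_ball hx n) fun i hi => trunc_apply_of_le hi _
  have hterm (α : ℕ →₀ ℕ) :
      c α * monomial (trunc n x) α = if α ∈ S then c α * monomial x α else 0 := by
    by_cases h : c α = 0
    · simp only [h, zero_mul, ite_self]
    · rw [monomial_trunc, mul_ite, mul_zero]
      exact if_congr (hmem (hc α h)).symm rfl rfl
  simp only [sum_apply, smul_apply, smul_eq_mul, hA]
  rw [hsum.unique (hasSum_sum_of_ne_finset_zero fun α hα => by rw [hterm, if_neg hα])]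
  exact Finset.sum_congr rfl fun α hα => by rw [hterm, if_pos hα]

theorem exists_homPoly_of_coeff {g : HInfBall} {c : (ℕ →₀ ℕ) → ℂ} (hg : IsMonomialCoeff g c)
    (hc : ∀ α, c α ≠ 0 → α.degree = m) : ∃ P : HomPoly m, HomPoly.toHInfBall P = g := by
  obtain ⟨G, hGd, hG, hGM⟩ := HInfBall.exists_extension g
  choose B hB using fun n => ((isMonomialCoeff_iff hG).1 hg n).exists_form hc
  obtain ⟨L, hL⟩ := exists_multilinear_limit fun n => norm_symmetrize_apply_le (A := B n) (M := ‖g‖)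
    fun y hy => by
      rw [hB n y hy]
      exact hGM _ (trunc_mem_ball hy n)
  have hLG (x : CZeroBall) : (L fun _ => (x : CZero)) = G x := by
    refine hL _ _ ?_
    simp_rw [symmetrize_diag, hB _ _ (mem_ball_zero_iff.1 x.2)]
    exact (hGd.differentiableAt (Metric.isOpen_ball.mem_nhds x.2)).continuousAt.tendsto.comp
      (tendsto_trunc (x : CZero))
  exact ⟨⟨fun x => L fun _ => x, L, fun _ => rfl⟩,
    Subtype.ext (BoundedContinuousFunction.ext fun x => (hLG x).trans (hG x))⟩

theorem HomPoly.apply_smul (P : HomPoly m) (c : ℂ) (x : CZero) :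
    (P : CZero → ℂ) (c • x) = c ^ m * (P : CZero → ℂ) x := by
  obtain ⟨A, hA⟩ := P.2
  rw [hA, hA, A.map_smul_univ (fun _ => c) fun _ => x, Finset.prod_const, Finset.card_univ,
    Fintype.card_fin, smul_eq_mul]

theorem HomPoly.exists_symmetric_form (P : HomPoly m) :
    ∃ A : CZeroForm m, (∀ (σ : Equiv.Perm (Fin m)) x, A (fun i => x (σ i)) = A x) ∧
      ∀ x : CZero, (P : CZero → ℂ) x = A fun _ => x := by
  obtain ⟨A, hA⟩ := P.2
  exact ⟨symmetrize A, symmetrize_perm A, fun x => (hA x).trans (symmetrize_diag A x).symm⟩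

theorem HomPoly.toHInfBall_injective :
    Function.Injective (HomPoly.toHInfBall : HomPoly m → HInfBall) := by
  intro P Q h
  refine Subtype.ext (funext fun x => ?_)
  obtain ⟨t, ht0, ht⟩ : ∃ t : ℂ, t ≠ 0 ∧ t • x ∈ Metric.ball (0 : CZero) 1 := by
    have hx : (0 : ℝ) < ‖x‖ + 1 := by positivity
    refine ⟨((‖x‖ + 1 : ℝ) : ℂ)⁻¹, inv_ne_zero (by exact_mod_cast hx.ne'), ?_⟩
    rw [mem_ball_zero_iff, norm_smul, norm_inv, Complex.norm_of_nonneg hx.le, inv_mul_lt_one₀ hx]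
    exact lt_add_one _
  have hball : (P : CZero → ℂ) (t • x) = (Q : CZero → ℂ) (t • x) :=
    congr_arg (fun g : HInfBall => (g : CZeroBall →ᵇ ℂ) ⟨_, ht⟩) h
  rw [HomPoly.apply_smul, HomPoly.apply_smul] at hball
  exact mul_left_cancel₀ (pow_ne_zero m ht0) hball

end Homogeneous

section HomogeneousIsomorphism

variable {φ : HInfTorus ≃ₗᵢ[ℂ] HInfBall} (hφ : ∀ f, IsMonomialCoeff (φ f) (hardyCoeff f)) {m : ℕ}
include hφ

theorem apply_arensHardy {A : CZeroForm m} {P : HomPoly m}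
    (hA : ∀ x, (P : CZero → ℂ) x = A fun _ => x) : φ (arensHardy A) = HomPoly.toHInfBall P :=
  (hφ _).eq (isMonomialCoeff_arensHardy hA)

theorem exists_homPoly_linearEquiv (m : ℕ) :
    ∃ ψ : HomPoly m ≃ₗ[ℂ] HInfTorusHom m, ∀ P, φ (ψ P : HInfTorus) = HomPoly.toHInfBall P := by
  let restrict : HomPoly m →ₗ[ℂ] HInfBall :=
    { toFun := HomPoly.toHInfBall
      map_add' := fun _ _ => rfl
      map_smul' := fun _ _ => rfl }
  have hmem (P : HomPoly m) : φ.symm (restrict P) ∈ HInfTorusHom m := by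
    obtain ⟨A, hA⟩ := P.2
    have hP : φ.symm (restrict P) = arensHardy A :=
      φ.symm_apply_eq.2 (apply_arensHardy hφ hA).symm
    rw [hP]
    exact arensHardy_mem A
  let ψ : HomPoly m →ₗ[ℂ] HInfTorusHom m :=
    ((φ.symm.toLinearEquiv : HInfBall →ₗ[ℂ] HInfTorus) ∘ₗ restrict).codRestrict _ hmem
  have hψ (P : HomPoly m) : φ (ψ P : HInfTorus) = HomPoly.toHInfBall P := φ.apply_symm_apply _
  refine ⟨LinearEquiv.ofBijective ψ ⟨fun P Q h => HomPoly.toHInfBall_injective ?_, fun f => ?_⟩, hψ⟩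
  · rw [← hψ, ← hψ, h]
  · obtain ⟨P, hP⟩ := exists_homPoly_of_coeff (hφ f) f.2
    exact ⟨P, Subtype.ext (φ.injective ((hψ P).trans hP))⟩

theorem exists_isAronBernerExtension {f : HInfTorus} {P : HomPoly m}
    (hf : φ f = HomPoly.toHInfBall P) :
    ∃ Q : EllInf → ℂ, IsAronBernerExtension P Q ∧
      ((f : LInfTorus) : Torus → ℂ) =ᵐ[torusMeasure] fun w => Q w.toEllInf := by
  obtain ⟨A, hsymm, hA⟩ := HomPoly.exists_symmetric_form P
  obtain rfl : f = arensHardy A := φ.injective (hf.trans (apply_arensHardy hφ hA).symm)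
  exact ⟨fun z => arens m A fun _ => z,
    ⟨A, arens m A, hsymm, hA, isArensExtension_arens A, fun _ => rfl⟩, coeFn_arensHardy A⟩

end HomogeneousIsomorphism

end

end PolyHardy

open PolyHardy

theorem proposition4p6 :
    ∃ φ : PolyHardy.HInfTorus ≃ₗᵢ[ℂ] PolyHardy.HInfBall,
      (∀ f : PolyHardy.HInfTorus,
        PolyHardy.IsMonomialCoeff (φ f) (PolyHardy.hardyCoeff f)) ∧
      (∀ φ' : PolyHardy.HInfTorus → PolyHardy.HInfBall,
        (∀ f : PolyHardy.HInfTorus,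
          PolyHardy.IsMonomialCoeff (φ' f) (PolyHardy.hardyCoeff f)) →
        ∀ f, φ' f = φ f) ∧
      ∀ m : ℕ, ∃ ψ : PolyHardy.HomPoly m ≃ₗ[ℂ] PolyHardy.HInfTorusHom m,
        (∀ P : PolyHardy.HomPoly m, ∃ Q : PolyHardy.EllInf → ℂ,
          PolyHardy.IsAronBernerExtension P Q ∧
          (((ψ P : PolyHardy.HInfTorus) : PolyHardy.LInfTorus) : PolyHardy.Torus → ℂ)
            =ᵐ[PolyHardy.torusMeasure] fun w => Q (PolyHardy.Torus.toEllInf w)) ∧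
        (∀ P : PolyHardy.HomPoly m, φ (ψ P : PolyHardy.HInfTorus) = PolyHardy.HomPoly.toHInfBall P) ∧
        (∀ f : PolyHardy.HInfTorusHom m,
          φ (f : PolyHardy.HInfTorus) = PolyHardy.HomPoly.toHInfBall (ψ.symm f)) := by
  obtain ⟨φ, hφ⟩ := exists_linearIsometryEquiv
  refine ⟨φ, hφ, fun φ' hφ' f => (hφ' f).eq (hφ f), fun m => ?_⟩
  obtain ⟨ψ, hψ⟩ := exists_homPoly_linearEquiv hφ m
  refine ⟨ψ, fun P => exists_isAronBernerExtension hφ (hψ P), hψ, fun f => ?_⟩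
  rw [← hψ, ψ.apply_symm_apply]
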